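/- An \emph{infinite frieze} of positive integers is an array $(m_{ij})_{i,j\in\mathbb{Z},\, j\ge i-2}$ of integers with $m_{i,i-2}=0$, $m_{i,i-1}=1$ for all $i$, $m_{ij}>0$ for all $i\le j$, and $m_{ij}m_{i+1,j+1}-m_{i+1,j}m_{i,j+1}=1$ for all $i,j$ with $j\ge i-1$. Its \emph{quiddity row} is $(a_i)_{i\in\mathbb{Z}}$ with $a_i=m_{ii}$. For $A\subseteq\mathbb{Q}$ let $\mathbb{V}_A$ be the strip $\mathbb{R}\times[0,1]$ with marked points $(i,0)$, $i\in\mathbb{Z}$, on the lower boundary and $(q,1)$, $q\in A$, on the upper boundary, together with two limit points $-\infty$ and $+\infty$ at its left and right extremities. An \emph{arc} of $\mathbb{V}_A$ is a curve without self-intersections in the interior of the strip that joins two distinct points among the marked points and the limit points $\pm\infty$, considered up to isotopy fixing the end points; boundary segments, i.e. segments between neighbouring marked points on the same boundary line, are not arcs. (Thus an arc joins two marked points, or a marked point and a limit point, or the two limit points; it is determined by its end points.) Two arcs are \emph{compatible} if they have representatives that do not intersect except possibly at common end points. A \emph{triangulation} of $\mathbb{V}_A$ is a maximal collection of pairwise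 compatible arcs; it is \emph{admissible} if each lower marked point $(i,0)$ is an end point of only finitely many of its arcs. A \emph{triangle} of a triangulation $T$ is given by three distinct points among the marked points and limit points such that any two of them are joined by an arc of $T$ or by a boundary segment. \textbf{Theorem.} Every infinite frieze of positive integers is realizable in the infinite strip: if $(a_i)_{i\in\mathbb{Z}}$ is its quiddity row, then there are a set $A\subseteq\mathbb{Q}$ and an admissible triangulation of $\mathbb{V}_A$ such that, for every $i\in\mathbb{Z}$, the number of triangles incident with $(i,0)$ is equal to $a_i$. -/

import Mathlib

open Filter Topology Set

/-- An infinite frieze of positive integers: an array `m i j`, where only the entries with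
`i - 2 ≤ j` belong to the frieze (the other values of `m` are irrelevant), satisfying the
unimodular rule on every diamond `m i j`, `m (i+1) j`, `m i (j+1)`, `m (i+1) (j+1)` all of
whose entries belong to the frieze. -/
structure IsInfiniteFrieze (m : ℤ → ℤ → ℤ) : Prop where
  zero_row : ∀ i, m i (i - 2) = 0
  one_row : ∀ i, m i (i - 1) = 1
  pos : ∀ i j, i ≤ j → 0 < m i j
  unimodular : ∀ i j, i - 1 ≤ j → m i j * m (i + 1) (j + 1) - m (i + 1) j * m i (j + 1) = 1

/-- The quiddity row of a frieze. -/
def quiddityRow (m : ℤ → ℤ → ℤ) (i : ℤ) : ℤ := m i i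

namespace Strip

/-- The possible end points of arcs in the strip `ℝ × [0, 1]`: the points `(i, 0)` with `i`
an integer, the points `(q, 1)` with `q` rational, and the two limit points `-∞` and `+∞` at
the left and right extremities of the strip. -/
inductive Pt : Type
  | lower (i : ℤ)
  | upper (q : ℚ)
  | negInf
  | posInf

/-- The end points that are available when `{(q, 1) | q ∈ A}` is the set of marked points on
the upper boundary. -/
def Pt.Available (A : Set ℚ) : Pt → Prop
  | .lower _ => True
  | .upper q => q ∈ A
  | .negInf => True
  | .posInf => True

/-- The neighbourhoods, in the plane, of an end point. A neighbourhood of `±∞` contains all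
points whose first coordinate is close enough to `±∞`. -/
def Pt.nhds : Pt → Filter (ℝ × ℝ)
  | .lower i => 𝓝 ((i : ℝ), (0 : ℝ))
  | .upper q => 𝓝 ((q : ℝ), (1 : ℝ))
  | .negInf => comap Prod.fst atBot
  | .posInf => comap Prod.fst atTop

/-- `γ`, restricted to the open interval `(0, 1)`, is a curve without self-intersections inside
the open strip `ℝ × (0, 1)` that starts at `x` and ends at `y`. -/
structure IsCurve (γ : ℝ → ℝ × ℝ) (x y : Pt) : Prop where
  continuousOn : ContinuousOn γ (Ioo 0 1)
  injOn : InjOn γ (Ioo 0 1)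
  mem_strip : ∀ t ∈ Ioo (0 : ℝ) 1, (γ t).2 ∈ Ioo (0 : ℝ) 1
  tendsto_start : Tendsto γ (𝓝[>] 0) x.nhds
  tendsto_end : Tendsto γ (𝓝[<] 1) y.nhds

/-- The segments of the boundary between neighbouring marked points of the same boundary line. -/
def IsBoundarySegment (A : Set ℚ) (e : Sym2 Pt) : Prop :=
  (∃ i : ℤ, e = s(.lower i, .lower (i + 1))) ∨
  (∃ p ∈ A, ∃ q ∈ A, p < q ∧ (∀ r ∈ A, ¬ (p < r ∧ r < q)) ∧ e = s(.upper p, .upper q))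

/-- Arcs, up to isotopy fixing the end points. The strip is simply connected, so that an
isotopy class is given by its two end points, which are distinct; boundary segments are not
arcs. This comprises peripheral arcs (both end points on the same boundary line), bridging arcs
(one on each), asymptotic arcs (from a marked point to `-∞` or to `+∞`), and the generic arc
`s(negInf, posInf)`. -/
def IsArc (A : Set ℚ) (e : Sym2 Pt) : Prop :=
  ¬ e.IsDiag ∧ (∀ x ∈ e, x.Available A) ∧ ¬ IsBoundarySegment A e

/-- `γ` is a representative of the isotopy class with end points `e`. -/
def Represents (γ : ℝ → ℝ × ℝ) (e : Sym2 Pt) : Prop :=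
  ∃ x y : Pt, e = s(x, y) ∧ IsCurve γ x y

/-- Two arcs are compatible if they have representatives that do not intersect (except possibly
in common end points). -/
def Compatible (e f : Sym2 Pt) : Prop :=
  ∃ γ δ : ℝ → ℝ × ℝ, Represents γ e ∧ Represents δ f ∧
    Disjoint (γ '' Ioo 0 1) (δ '' Ioo 0 1)

/-- A triangulation is a maximal collection of pairwise compatible arcs. -/
def IsTriangulation (A : Set ℚ) (T : Set (Sym2 Pt)) : Prop :=
  Maximal (fun S : Set (Sym2 Pt) => (∀ e ∈ S, IsArc A e) ∧ S.Pairwise Compatible) T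

/-- A triangulation is admissible if every vertex on the lower boundary is incident with only
finitely many arcs. -/
def IsAdmissibleTriangulation (A : Set ℚ) (T : Set (Sym2 Pt)) : Prop :=
  IsTriangulation A T ∧ ∀ i : ℤ, {e ∈ T | Pt.lower i ∈ e}.Finite

/-- The triangles of `T`, given by their three vertices: each of the three sides is an arc of `T`
or a boundary segment. -/
def triangles (A : Set ℚ) (T : Set (Sym2 Pt)) : Set (Finset Pt) :=
  {t | t.card = 3 ∧ ∀ x ∈ t, ∀ y ∈ t, x ≠ y → s(x, y) ∈ T ∨ IsBoundarySegment A s(x, y)}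

/-- The triangles of `T` incident with the lower vertex `(i, 0)`. -/
def trianglesAt (A : Set ℚ) (T : Set (Sym2 Pt)) (i : ℤ) : Set (Finset Pt) :=
  {t ∈ triangles A T | Pt.lower i ∈ t}

/-- The sequence `a` is realizable in the strip: for some set of marked points on the upper
boundary there is an admissible triangulation in which, for every `i`, the number of triangles
incident with `(i, 0)` is finite and equal to `a i`. -/
def Realizable (a : ℤ → ℤ) : Prop :=
  ∃ (A : Set ℚ) (T : Set (Sym2 Pt)), IsAdmissibleTriangulation A T ∧
    ∀ i : ℤ, (trianglesAt A T i).Finite ∧ ((trianglesAt A T i).ncard : ℤ) = a i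

end Strip

/-! A frieze is a table of determinants. The unimodular rule and positivity give linear recurrences
along rows and columns, and these produce lattice vectors v_j (`friezeVec`) with det(v_i, v_j) =
m_{i+1,j-1} for i < j (`det_friezeVec`). These are positive, and equal to 1 for consecutive indices.
So the v_j turn counterclockwise and span at most a half turn, with v_{j+1} = a_j v_j - v_{j-1}.

Let v_j be attached to (j,0), and take as upper marked points the rationals n/d in lowest terms
whose vector (n,d) comes after every v_j. Then the order of marked points around the strip is the
order of their vectors by direction (`det_pos_of_angle_lt`). Join two marked points when their
vectors form a lattice basis: this is a piece of the Farey graph, and the Plücker relation forbids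
crossings (`not_linked_of_det_eq_one`). Zorn's lemma extends its arcs to a triangulation.

The neighbours of (i,0) are found among w_k = k v_i - v_{i-1}, 0 ≤ k ≤ a_i, which run from -v_{i-1}
to v_{i+1} and satisfy det(v_i, w_k) = 1 and det(w_k, w_l) = k - l. Each w_k is, up to sign, the
vector of a marked point: either it comes after all v_j and is an upper point, or it changes sides
somewhere and integrality forces it to be ± a frieze vector (`exists_vertex_of_spokeVec`). This is a
closed fan of a_i triangles (`exists_fan`). Since a further arc at (i,0) would cross the fan, the
count holds in every triangulation extending it (`triangles_of_fan`), and admissibility comes for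
free.

Compatibility is defined with actual curves, so it has to be made combinatorial. The strip is mapped
to a disc and end points become angles; unlinked pairs are realized by straight chords
(`compatible_of_not_linked`), while curves with linked end points must meet, by a winding argument
(`not_compatible_of_linked`). -/

namespace Strip

/-! ### Crossing of curves in the disc with linked end points -/

/-- A continuous angle that stays in an open half plane cannot change its branch. -/
theorem angle_sub_eq_of_cos_pos {L : ℝ → ℝ} (hL : ContinuousOn L (Icc 0 1)) {φ β₀ β₁ : ℝ}
    (h₀ : |β₀ - φ| < Real.pi / 2) (h₁ : |β₁ - φ| < Real.pi / 2)
    (hcos : ∀ t ∈ Icc (0 : ℝ) 1, 0 < Real.cos (L t - φ)) {n₀ n₁ : ℤ}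
    (e₀ : L 0 = β₀ + n₀ * (2 * Real.pi)) (e₁ : L 1 = β₁ + n₁ * (2 * Real.pi)) :
    L 1 - L 0 = β₁ - β₀ := by
  have hpi := Real.pi_pos
  -- Normalizing by the initial branch puts `w 0` in (-π/2, π/2). By the intermediate value theorem
  -- `w` could leave this interval only through a zero of the cosine.
  set w : ℝ → ℝ := fun t => L t - φ - n₀ * (2 * Real.pi) with hw
  have hwc : ContinuousOn w (Icc 0 1) := (hL.sub continuousOn_const).sub continuousOn_const
  have hwcos : ∀ t ∈ Icc (0 : ℝ) 1, 0 < Real.cos (w t) := fun t ht => by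
    simpa [hw, Real.cos_sub_int_mul_two_pi] using hcos t ht
  have hw0 : w 0 = β₀ - φ := by simp only [hw, e₀]; ring
  have hw1 : w 1 = β₁ - φ + ((n₁ - n₀ : ℤ) : ℝ) * (2 * Real.pi) := by
    simp only [hw, e₁]; push_cast; ring
  rw [abs_lt] at h₀ h₁
  have key : |w 1| < Real.pi / 2 := by
    rw [abs_lt]
    constructor
    · by_contra hcon
      obtain ⟨t, ht, hte⟩ : -(Real.pi / 2) ∈ w '' Icc 0 1 :=
        intermediate_value_Icc' zero_le_one hwc ⟨by linarith, by linarith⟩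
      have := hwcos t ht
      rw [hte] at this; simp at this
    · by_contra hcon
      obtain ⟨t, ht, hte⟩ : (Real.pi / 2) ∈ w '' Icc 0 1 :=
        intermediate_value_Icc zero_le_one hwc ⟨by linarith, by linarith⟩
      have := hwcos t ht
      rw [hte] at this; simp at this
  rw [abs_lt, hw1] at key
  -- Both `w 1` and `β₁ - φ` have absolute value below π/2, so they differ by less than π, too
  -- little for a nonzero multiple of 2π.
  have hn : n₁ - n₀ = 0 := by
    have h1 : ((n₁ - n₀ : ℤ) : ℝ) < 1 := by nlinarith
    have h2 : (-1 : ℝ) < ((n₁ - n₀ : ℤ) : ℝ) := by nlinarith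
    have h1' : n₁ - n₀ < 1 := by exact_mod_cast h1
    have h2' : -1 < n₁ - n₀ := by exact_mod_cast h2
    omega
  have : n₁ = n₀ := by omega
  subst this
  rw [e₀, e₁]; ring

/-- The point of the unit circle at angle `a`. -/
noncomputable def circlePt (a : ℝ) : ℂ := ⟨Real.cos a, Real.sin a⟩

theorem circlePt_eq_exp (a : ℝ) : circlePt a = Complex.exp (a * Complex.I) := by
  rw [Complex.exp_mul_I]
  apply Complex.ext <;> simp [circlePt, Complex.cos_ofReal_re, Complex.sin_ofReal_re]

theorem circlePt_add_two_pi (a : ℝ) : circlePt (a + 2 * Real.pi) = circlePt a := by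
  simp [circlePt]

theorem normSq_circlePt (a : ℝ) : Complex.normSq (circlePt a) = 1 := by
  rw [Complex.normSq_apply]
  have := Real.sin_sq_add_cos_sq a
  simp only [circlePt]; linarith

theorem norm_circlePt (a : ℝ) : ‖circlePt a‖ = 1 := by
  have := normSq_circlePt a
  rw [Complex.normSq_eq_norm_sq] at this
  nlinarith [norm_nonneg (circlePt a)]

theorem circlePt_ne {a b : ℝ} (hab : a < b) (hba : b < a + 2 * Real.pi) :
    circlePt a ≠ circlePt b := by
  intro h
  have h1 := congrArg Complex.re h
  have h2 := congrArg Complex.im h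
  simp only [circlePt] at h1 h2
  have : Real.cos (b - a) = 1 := by
    rw [Real.cos_sub, ← h1, ← h2]; nlinarith [Real.sin_sq_add_cos_sq a]
  rw [Real.cos_eq_one_iff_of_lt_of_lt (by linarith [Real.pi_pos]) (by linarith)] at this
  linarith

/-- A point of the closed disc other than `circlePt a` has scalar product less than `1` with it. -/
theorem dot_circlePt_lt_one {z : ℂ} (hz : ‖z‖ ≤ 1) {a : ℝ} (hne : z ≠ circlePt a) :
    z.re * Real.cos a + z.im * Real.sin a < 1 := by
  have h1 : z.re * z.re + z.im * z.im ≤ 1 := by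
    rw [← Complex.normSq_apply, Complex.normSq_eq_norm_sq]; nlinarith [norm_nonneg z]
  have h2 := Real.sin_sq_add_cos_sq a
  by_contra hcon
  apply hne
  have e1 : z.re - Real.cos a = 0 := by
    nlinarith [sq_nonneg (z.re - Real.cos a), sq_nonneg (z.im - Real.sin a)]
  have e2 : z.im - Real.sin a = 0 := by
    nlinarith [sq_nonneg (z.re - Real.cos a), sq_nonneg (z.im - Real.sin a)]
  apply Complex.ext <;> simp only [circlePt] <;> linarith

/-- If `exp w` has a positive scalar product with direction `φ`, so has the direction `w.im`. -/
theorem cos_im_sub_pos {w : ℂ} {φ : ℝ}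
    (h : 0 < (Complex.exp w).re * Real.cos φ + (Complex.exp w).im * Real.sin φ) :
    0 < Real.cos (w.im - φ) := by
  rw [Complex.exp_re, Complex.exp_im] at h
  have : 0 < Real.exp w.re * Real.cos (w.im - φ) := by
    rw [Real.cos_sub]; linarith
  exact (pos_iff_pos_of_mul_pos this).1 (Real.exp_pos _)

theorem exists_im_eq_of_exp_eq {w : ℂ} {r β : ℝ} (hr : 0 < r)
    (h : Complex.exp w = r * circlePt β) : ∃ n : ℤ, w.im = β + n * (2 * Real.pi) := by
  rw [circlePt_eq_exp, ← Real.exp_log hr, Complex.ofReal_exp, ← Complex.exp_add,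
    Complex.exp_eq_exp_iff_exists_int] at h
  obtain ⟨n, hn⟩ := h
  refine ⟨n, ?_⟩
  rw [hn]
  simp

/-- A chord is perpendicular to the bisector of its two angles. The real factor is positive when `a
< b < a + 2π`, so the last angle is then an argument of the difference. -/
theorem circlePt_sub (a b : ℝ) : circlePt a - circlePt b =
    ((2 * Real.sin ((b - a) / 2) : ℝ) : ℂ) * circlePt ((a + b) / 2 - Real.pi / 2) := by
  have e1 : Real.cos ((a + b) / 2 - Real.pi / 2) = Real.sin ((a + b) / 2) := by
    rw [Real.cos_sub_pi_div_two]
  have e2 : Real.sin ((a + b) / 2 - Real.pi / 2) = - Real.cos ((a + b) / 2) := by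
    rw [Real.sin_sub_pi_div_two]
  have e3 : Real.sin ((b - a) / 2) = - Real.sin ((a - b) / 2) := by
    rw [← Real.sin_neg]; congr 1; ring
  apply Complex.ext
  · rw [Complex.re_ofReal_mul]
    simp only [circlePt, Complex.sub_re, e1, e3, Real.cos_sub_cos a b]; ring
  · rw [Complex.im_ofReal_mul]
    simp only [circlePt, Complex.sub_im, e2, e3, Real.sin_sub_sin a b]; ring

/-- The plane is simply connected and the exponential covers the punctured plane, so `F` lifts. -/
theorem exists_continuous_log {F : ℝ × ℝ → ℂ} (hF : Continuous F) (h0 : ∀ p, F p ≠ 0) :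
    ∃ L : ℝ × ℝ → ℂ, Continuous L ∧ ∀ p, Complex.exp (L p) = F p := by
  obtain ⟨L, ⟨-, hL⟩, -⟩ := Complex.isCoveringMapOn_exp.existsUnique_continuousMap_lifts
    (⟨F, hF⟩ : C(ℝ × ℝ, ℂ)) (a₀ := 0) (e₀ := Complex.log (F 0))
    (by simp [Complex.exp_log (h0 0)]) (fun p => by simpa using h0 p)
  exact ⟨L, L.continuous, fun p => congrFun hL p⟩

/-- Two curves in the closed unit disc whose end points on the circle are linked intersect. -/
theorem exists_eq_of_linked_in_disc {g h : ℝ → ℂ} (hg : ContinuousOn g (Icc 0 1))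
    (hh : ContinuousOn h (Icc 0 1)) (hg1 : ∀ t ∈ Ioo (0 : ℝ) 1, ‖g t‖ < 1)
    (hh1 : ∀ t ∈ Ioo (0 : ℝ) 1, ‖h t‖ < 1) {a b c d : ℝ} (ga : g 0 = circlePt a)
    (gb : g 1 = circlePt b) (hc : h 0 = circlePt c) (hd : h 1 = circlePt d)
    (hac : a < c) (hcb : c < b) (hbd : b < d) (hda : d < a + 2 * Real.pi) :
    ∃ s ∈ Ioo (0 : ℝ) 1, ∃ t ∈ Ioo (0 : ℝ) 1, g s = h t := by
  by_contra! hne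
  have hpi := Real.pi_pos
  have nac := circlePt_ne hac (by linarith)
  have nad := circlePt_ne (hac.trans (hcb.trans hbd)) hda
  have ncb := circlePt_ne hcb (by linarith)
  have nbd := circlePt_ne hbd (by linarith)
  have cases01 : ∀ t ∈ Icc (0 : ℝ) 1, t = 0 ∨ t = 1 ∨ t ∈ Ioo (0 : ℝ) 1 := fun t ht => by
    rcases eq_or_lt_of_le ht.1 with h | h
    · exact Or.inl h.symm
    rcases eq_or_lt_of_le ht.2 with h' | h'
    · exact Or.inr (Or.inl h')
    exact Or.inr (Or.inr ⟨h, h'⟩)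
  have lt_ne : ∀ (z : ℂ) (x : ℝ), ‖z‖ < 1 → z ≠ circlePt x := fun z x hz h => by
    rw [h, norm_circlePt] at hz; exact lt_irrefl _ hz
  have gle : ∀ t ∈ Icc (0 : ℝ) 1, ‖g t‖ ≤ 1 ∧ g t ≠ circlePt c ∧ g t ≠ circlePt d := by
    intro t ht
    rcases cases01 t ht with rfl | rfl | ht
    · rw [ga]; exact ⟨(norm_circlePt a).le, nac, nad⟩
    · rw [gb]; exact ⟨(norm_circlePt b).le, ncb.symm, nbd⟩
    · exact ⟨(hg1 t ht).le, lt_ne _ _ (hg1 t ht), lt_ne _ _ (hg1 t ht)⟩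
  have hle : ∀ t ∈ Icc (0 : ℝ) 1, ‖h t‖ ≤ 1 ∧ h t ≠ circlePt a ∧ h t ≠ circlePt b := by
    intro t ht
    rcases cases01 t ht with rfl | rfl | ht
    · rw [hc]; exact ⟨(norm_circlePt c).le, nac.symm, ncb⟩
    · rw [hd]; exact ⟨(norm_circlePt d).le, nad.symm, nbd.symm⟩
    · exact ⟨(hh1 t ht).le, lt_ne _ _ (hh1 t ht), lt_ne _ _ (hh1 t ht)⟩
  have hne' : ∀ s ∈ Icc (0 : ℝ) 1, ∀ t ∈ Icc (0 : ℝ) 1, g s - h t ≠ 0 := by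
    intro s hs t ht
    rw [sub_ne_zero]
    rcases cases01 s hs with rfl | rfl | hs'
    · rw [ga]; exact (hle t ht).2.1.symm
    · rw [gb]; exact (hle t ht).2.2.symm
    rcases cases01 t ht with rfl | rfl | ht'
    · rw [hc]; exact (gle s hs).2.1
    · rw [hd]; exact (gle s hs).2.2
    exact hne s hs' t ht'
  -- Clamping to [0, 1] extends the nonvanishing difference `g s - h t` from the square to the whole
  -- plane, where a logarithm exists.
  set p : ℝ → ℝ := fun t => (projIcc (0 : ℝ) 1 zero_le_one t : ℝ) with hp
  have pc : Continuous p := continuous_subtype_val.comp continuous_projIcc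
  have pm : ∀ t, p t ∈ Icc (0 : ℝ) 1 := fun t => (projIcc (0 : ℝ) 1 zero_le_one t).2
  have pe : ∀ t ∈ Icc (0 : ℝ) 1, p t = t := fun t ht => by simp [hp, projIcc_of_mem zero_le_one ht]
  obtain ⟨L, hLc, hL⟩ := exists_continuous_log (F := fun q => g (p q.1) - h (p q.2))
    (((hg.comp_continuous pc pm).comp continuous_fst).sub
      ((hh.comp_continuous pc pm).comp continuous_snd)) (fun q => hne' _ (pm _) _ (pm _))
  have hL' : ∀ s ∈ Icc (0 : ℝ) 1, ∀ t ∈ Icc (0 : ℝ) 1, Complex.exp (L (s, t)) = g s - h t := by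
    intro s hs t ht
    rw [hL]; simp only [pe s hs, pe t ht]
  have m0 : (0 : ℝ) ∈ Icc (0 : ℝ) 1 := ⟨le_rfl, zero_le_one⟩
  have m1 : (1 : ℝ) ∈ Icc (0 : ℝ) 1 := ⟨zero_le_one, le_rfl⟩
  have spos : ∀ x y : ℝ, x < y → y < x + 2 * Real.pi → 0 < 2 * Real.sin ((y - x) / 2) :=
    fun x y h1 h2 => mul_pos two_pos (Real.sin_pos_of_pos_of_lt_pi (by linarith) (by linarith))
  obtain ⟨n00, e00⟩ := exists_im_eq_of_exp_eq (spos a c hac (by linarith))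
    (by rw [hL' 0 m0 0 m0, ga, hc, circlePt_sub])
  obtain ⟨n01, e01⟩ := exists_im_eq_of_exp_eq (spos a d (by linarith) (by linarith))
    (by rw [hL' 0 m0 1 m1, ga, hd, circlePt_sub])
  obtain ⟨n11, e11⟩ := exists_im_eq_of_exp_eq (spos b d hbd (by linarith))
    (by rw [hL' 1 m1 1 m1, gb, hd, circlePt_sub])
  obtain ⟨n10, e10⟩ := exists_im_eq_of_exp_eq (w := L (1, 0)) (β := (c + b) / 2 + Real.pi / 2)
    (spos c b hcb (by linarith)) (by
      rw [hL' 1 m1 0 m0, gb, hc, ← neg_sub, circlePt_sub, ← mul_neg]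
      congr 1
      have : (c + b) / 2 + Real.pi / 2 = (c + b) / 2 - Real.pi / 2 + Real.pi := by ring
      rw [this]
      apply Complex.ext <;> simp [circlePt])
  -- On each side of the square one curve sits at a point of the circle and the other stays in the
  -- closed disc away from it. The difference thus stays in an open half plane, and its change of
  -- argument is read off from the corners.
  have side0 := angle_sub_eq_of_cos_pos (L := fun t => (L (0, t)).im) (φ := a)
    (by fun_prop) (β₀ := (a + c) / 2 - Real.pi / 2) (β₁ := (a + d) / 2 - Real.pi / 2)
    (by rw [abs_lt]; constructor <;> linarith) (by rw [abs_lt]; constructor <;> linarith)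
    (fun t ht => cos_im_sub_pos (by
      rw [hL' 0 m0 t ht, ga]
      have := dot_circlePt_lt_one (hle t ht).1 (hle t ht).2.1
      have h2 := Real.sin_sq_add_cos_sq a
      simp only [Complex.sub_re, Complex.sub_im, circlePt]; nlinarith)) e00 e01
  have side1 := angle_sub_eq_of_cos_pos (L := fun t => (L (1, t)).im) (φ := b)
    (by fun_prop) (β₀ := (c + b) / 2 + Real.pi / 2) (β₁ := (b + d) / 2 - Real.pi / 2)
    (by rw [abs_lt]; constructor <;> linarith) (by rw [abs_lt]; constructor <;> linarith)
    (fun t ht => cos_im_sub_pos (by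
      rw [hL' 1 m1 t ht, gb]
      have := dot_circlePt_lt_one (hle t ht).1 (hle t ht).2.2
      have h2 := Real.sin_sq_add_cos_sq b
      simp only [Complex.sub_re, Complex.sub_im, circlePt]; nlinarith)) e10 e11
  have top := angle_sub_eq_of_cos_pos (L := fun s => (L (s, 1)).im) (φ := d - Real.pi)
    (by fun_prop) (β₀ := (a + d) / 2 - Real.pi / 2) (β₁ := (b + d) / 2 - Real.pi / 2)
    (by rw [abs_lt]; constructor <;> linarith) (by rw [abs_lt]; constructor <;> linarith)
    (fun t ht => cos_im_sub_pos (by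
      rw [hL' t ht 1 m1, hd, Real.cos_sub_pi, Real.sin_sub_pi]
      have := dot_circlePt_lt_one (gle t ht).1 (gle t ht).2.2
      have h2 := Real.sin_sq_add_cos_sq d
      simp only [Complex.sub_re, Complex.sub_im, circlePt]; nlinarith)) e01 e11
  -- The half plane here is centred at `c + π`, so the initial argument needs the representative
  -- shifted by 2π; this compensates for the index `n00 - 1`.
  have bot := angle_sub_eq_of_cos_pos (L := fun s => (L (s, 0)).im) (φ := c + Real.pi)
    (by fun_prop) (β₀ := (a + c) / 2 - Real.pi / 2 + 2 * Real.pi)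
    (β₁ := (c + b) / 2 + Real.pi / 2) (n₀ := n00 - 1)
    (by rw [abs_lt]; constructor <;> linarith) (by rw [abs_lt]; constructor <;> linarith)
    (fun t ht => cos_im_sub_pos (by
      rw [hL' t ht 0 m0, hc, Real.cos_add_pi, Real.sin_add_pi]
      have := dot_circlePt_lt_one (gle t ht).1 (gle t ht).2.1
      have h2 := Real.sin_sq_add_cos_sq c
      simp only [Complex.sub_re, Complex.sub_im, circlePt]; nlinarith))
    (by rw [e00]; push_cast; ring) e10
  -- Going from corner (0,0) to (1,1), the two routes along the boundary give changes of argument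
  -- that differ by 2π, which is impossible for a single-valued `L`.
  linarith

end Strip

/-! ### The strip as a disc -/

namespace Strip

/-- A homeomorphism of the strip onto the closed unit disc without the points `±1`. -/
noncomputable def toDisc (p : ℝ × ℝ) : ℂ :=
  ⟨Real.sin (Real.arctan p.1), (2 * p.2 - 1) * Real.cos (Real.arctan p.1)⟩

/-- The inverse of `toDisc`. -/
noncomputable def ofDisc (z : ℂ) : ℝ × ℝ :=
  (Real.tan (Real.arcsin z.re), (1 + z.im / Real.cos (Real.arcsin z.re)) / 2)

/-- The angle of the point of the unit circle that corresponds to an end point. -/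
noncomputable def angle : Pt → ℝ
  | .lower i => Real.arctan i - Real.pi / 2
  | .upper q => Real.pi / 2 - Real.arctan q
  | .negInf => -Real.pi
  | .posInf => 0

theorem neg_pi_le_angle (x : Pt) : -Real.pi ≤ angle x := by
  have hpi := Real.pi_pos
  rcases x with i | q | _ | _ <;> simp only [angle]
  · linarith [Real.neg_pi_div_two_lt_arctan i]
  · linarith [Real.arctan_lt_pi_div_two q]
  · exact le_rfl
  · linarith

theorem angle_lt_pi (x : Pt) : angle x < Real.pi := by
  have hpi := Real.pi_pos
  rcases x with i | q | _ | _ <;> simp only [angle]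
  · linarith [Real.arctan_lt_pi_div_two i]
  · linarith [Real.neg_pi_div_two_lt_arctan q]
  · linarith
  · linarith

theorem angle_lower_lt {i j : ℤ} : angle (.lower i) < angle (.lower j) ↔ i < j := by
  simp [angle]

theorem angle_upper_lt {p q : ℚ} : angle (.upper p) < angle (.upper q) ↔ q < p := by
  simp [angle]

theorem angle_lower_neg (i : ℤ) : angle (.lower i) < 0 := by
  simp only [angle]; linarith [Real.arctan_lt_pi_div_two i]

theorem neg_pi_lt_angle_lower (i : ℤ) : -Real.pi < angle (.lower i) := by
  simp only [angle]; linarith [Real.neg_pi_div_two_lt_arctan i]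

theorem angle_upper_pos (q : ℚ) : 0 < angle (.upper q) := by
  simp only [angle]; linarith [Real.arctan_lt_pi_div_two q]

theorem angle_injective : Function.Injective angle := by
  have hpi := Real.pi_pos
  intro x y h
  rcases x with i | q | _ | _ <;> rcases y with j | r | _ | _
  case lower.lower => simpa [angle] using h
  case upper.upper => simpa [angle] using h
  all_goals first | rfl | exfalso
  all_goals
    try have := angle_lower_neg i
    try have := neg_pi_lt_angle_lower i
    try have := angle_lower_neg j
    try have := neg_pi_lt_angle_lower j
    try have := angle_upper_pos q
    try have := angle_upper_pos r
    simp only [angle] at *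
    linarith

theorem continuous_toDisc : Continuous toDisc := by
  have : toDisc = fun p : ℝ × ℝ => Complex.equivRealProdCLM.symm
      (Real.sin (Real.arctan p.1), (2 * p.2 - 1) * Real.cos (Real.arctan p.1)) := by
    funext p; rfl
  rw [this]
  fun_prop

theorem norm_lt_one_iff {z : ℂ} : ‖z‖ < 1 ↔ z.re ^ 2 + z.im ^ 2 < 1 := by
  rw [← sq_lt_one_iff₀ (norm_nonneg z), ← Complex.normSq_eq_norm_sq, Complex.normSq_apply]
  simp only [sq]

theorem norm_toDisc_lt_one {p : ℝ × ℝ} (hp : p.2 ∈ Ioo (0 : ℝ) 1) : ‖toDisc p‖ < 1 := by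
  rw [norm_lt_one_iff]
  have h1 := Real.sin_sq_add_cos_sq (Real.arctan p.1)
  have h2 : 0 < Real.cos (Real.arctan p.1) ^ 2 := pow_pos (Real.cos_arctan_pos _) 2
  have h3 : (2 * p.2 - 1) ^ 2 < 1 := by nlinarith [hp.1, hp.2]
  simp only [toDisc, mul_pow]
  nlinarith

theorem toDisc_injective : Function.Injective toDisc := by
  intro p q h
  have h1 := congrArg Complex.re h
  have h2 := congrArg Complex.im h
  simp only [toDisc] at h1 h2
  have e : p.1 = q.1 := by
    apply Real.arctan_injective
    refine Real.injOn_sin ?_ ?_ h1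
    all_goals exact ⟨(Real.neg_pi_div_two_lt_arctan _).le, (Real.arctan_lt_pi_div_two _).le⟩
  rw [e] at h2
  have := mul_right_cancel₀ (Real.cos_arctan_pos q.1).ne' h2
  exact Prod.ext e (by linarith)

theorem tendsto_complex_mk {α : Type*} {l : Filter α} {f : α → ℂ} {z : ℂ}
    (h1 : Tendsto (fun t => (f t).re) l (𝓝 z.re)) (h2 : Tendsto (fun t => (f t).im) l (𝓝 z.im)) :
    Tendsto f l (𝓝 z) :=
  (Complex.equivRealProdCLM.symm.continuous.tendsto (z.re, z.im)).comp (h1.prodMk_nhds h2)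

/-- Neighbourhoods of ±∞ do not bound the second coordinate, hence the restriction to the open
strip: there the imaginary part is at most cos(arctan x), which tends to 0. -/
theorem tendsto_toDisc (x : Pt) :
    Tendsto toDisc (x.nhds ⊓ 𝓟 {p | p.2 ∈ Ioo (0 : ℝ) 1}) (𝓝 (circlePt (angle x))) := by
  have im_small : ∀ p : ℝ × ℝ, p.2 ∈ Ioo (0 : ℝ) 1 →
      ‖(toDisc p).im‖ ≤ Real.cos (Real.arctan p.1) := fun p hp => by
    have h3 : |2 * p.2 - 1| ≤ 1 := by rw [abs_le]; constructor <;> linarith [hp.1, hp.2]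
    have h4 := Real.cos_arctan_pos p.1
    simp only [toDisc, Real.norm_eq_abs, abs_mul, abs_of_pos h4]
    nlinarith
  rcases x with i | q | _ | _
  · refine Tendsto.mono_left ?_ inf_le_left
    have e : circlePt (angle (.lower i)) = toDisc ((i : ℝ), (0 : ℝ)) := by
      simp [toDisc, circlePt, angle, Real.cos_sub_pi_div_two, Real.sin_sub_pi_div_two]
    rw [e]
    exact continuous_toDisc.tendsto _
  · refine Tendsto.mono_left ?_ inf_le_left
    have e : circlePt (angle (.upper q)) = toDisc ((q : ℝ), (1 : ℝ)) := by
      simp only [toDisc, circlePt, angle, Real.cos_pi_div_two_sub, Real.sin_pi_div_two_sub]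
      norm_num
    rw [e]
    exact continuous_toDisc.tendsto _
  · have ha : Tendsto (fun p : ℝ × ℝ => Real.arctan p.1)
        (Pt.negInf.nhds ⊓ 𝓟 {p | p.2 ∈ Ioo (0 : ℝ) 1}) (𝓝 (-(Real.pi / 2))) :=
      ((Real.tendsto_arctan_atBot.mono_right nhdsWithin_le_nhds).comp tendsto_comap).mono_left
        inf_le_left
    refine tendsto_complex_mk ?_ ?_
    · have e : (circlePt (angle .negInf)).re = Real.sin (-(Real.pi / 2)) := by simp [circlePt, angle]
      rw [e]
      exact (Real.continuous_sin.tendsto _).comp ha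
    · have hz : (circlePt (angle .negInf)).im = 0 := by simp [circlePt, angle]
      rw [hz]
      refine squeeze_zero_norm' (a := fun p : ℝ × ℝ => Real.cos (Real.arctan p.1)) ?_ ?_
      · exact eventually_inf_principal.2 (Eventually.of_forall im_small)
      · have e : Real.cos (-(Real.pi / 2)) = 0 := by simp
        have hl := (Real.continuous_cos.tendsto _).comp ha
        rw [e] at hl
        exact hl
  · have ha : Tendsto (fun p : ℝ × ℝ => Real.arctan p.1)
        (Pt.posInf.nhds ⊓ 𝓟 {p | p.2 ∈ Ioo (0 : ℝ) 1}) (𝓝 (Real.pi / 2)) :=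
      ((Real.tendsto_arctan_atTop.mono_right nhdsWithin_le_nhds).comp tendsto_comap).mono_left
        inf_le_left
    refine tendsto_complex_mk ?_ ?_
    · have e : (circlePt (angle .posInf)).re = Real.sin (Real.pi / 2) := by simp [circlePt, angle]
      rw [e]
      exact (Real.continuous_sin.tendsto _).comp ha
    · have hz : (circlePt (angle .posInf)).im = 0 := by simp [circlePt, angle]
      rw [hz]
      refine squeeze_zero_norm' (a := fun p : ℝ × ℝ => Real.cos (Real.arctan p.1)) ?_ ?_
      · exact eventually_inf_principal.2 (Eventually.of_forall im_small)
      · have e : Real.cos (Real.pi / 2) = 0 := by simp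
        have hl := (Real.continuous_cos.tendsto _).comp ha
        rw [e] at hl
        exact hl

theorem cos_arcsin_sq {z : ℂ} (hz : ‖z‖ < 1) : Real.cos (Real.arcsin z.re) ^ 2 = 1 - z.re ^ 2 := by
  rw [norm_lt_one_iff] at hz
  rw [Real.cos_arcsin, Real.sq_sqrt]
  nlinarith [sq_nonneg z.im]

theorem cos_arcsin_pos {z : ℂ} (hz : ‖z‖ < 1) : 0 < Real.cos (Real.arcsin z.re) := by
  rw [norm_lt_one_iff] at hz
  rw [Real.cos_arcsin, Real.sqrt_pos]
  nlinarith [sq_nonneg z.im]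

theorem abs_re_lt_one {z : ℂ} (hz : ‖z‖ < 1) : -1 < z.re ∧ z.re < 1 := by
  rw [← abs_lt]; exact (Complex.abs_re_le_norm z).trans_lt hz

theorem toDisc_ofDisc {z : ℂ} (hz : ‖z‖ < 1) : toDisc (ofDisc z) = z := by
  have h := cos_arcsin_pos hz
  obtain ⟨h1, h2⟩ := abs_re_lt_one hz
  have e : Real.arctan (Real.tan (Real.arcsin z.re)) = Real.arcsin z.re :=
    Real.arctan_tan (Real.neg_pi_div_two_lt_arcsin.2 h1) (Real.arcsin_lt_pi_div_two.2 h2)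
  apply Complex.ext
  · simp only [toDisc, ofDisc, e, Real.sin_arcsin h1.le h2.le]
  · simp only [toDisc, ofDisc, e]
    field_simp
    ring

theorem ofDisc_mem_strip {z : ℂ} (hz : ‖z‖ < 1) : (ofDisc z).2 ∈ Ioo (0 : ℝ) 1 := by
  have h := cos_arcsin_pos hz
  have h' := cos_arcsin_sq hz
  rw [norm_lt_one_iff] at hz
  have : |z.im / Real.cos (Real.arcsin z.re)| < 1 := by
    rw [← sq_lt_one_iff_abs_lt_one, div_pow, div_lt_one (by positivity)]
    linarith
  rw [abs_lt] at this
  constructor <;> simp only [ofDisc] <;> linarith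

theorem continuousAt_ofDisc {z : ℂ} (h : Real.cos (Real.arcsin z.re) ≠ 0) :
    ContinuousAt ofDisc z := by
  have hre : ContinuousAt (fun z : ℂ => Real.arcsin z.re) z :=
    (Real.continuous_arcsin.comp Complex.continuous_re).continuousAt
  have h1 : ContinuousAt (fun z : ℂ => Real.tan (Real.arcsin z.re)) z :=
    ContinuousAt.comp (f := fun z : ℂ => Real.arcsin z.re) (Real.continuousAt_tan.2 h) hre
  have h2 : ContinuousAt (fun z : ℂ => Real.cos (Real.arcsin z.re)) z :=
    Real.continuous_cos.continuousAt.comp hre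
  exact h1.prodMk ((continuousAt_const.add
    (Complex.continuous_im.continuousAt.div h2 h)).div_const 2)

/-- The restriction to the open disc matters at ±∞: it keeps the arcsine strictly inside (-π/2,
π/2), so that the tangent diverges with the right sign. -/
theorem tendsto_ofDisc (x : Pt) :
    Tendsto ofDisc (𝓝 (circlePt (angle x)) ⊓ 𝓟 {z | ‖z‖ < 1}) x.nhds := by
  have harc : ∀ y : ℝ, Real.arcsin (Real.sin (Real.arctan y)) = Real.arctan y := fun y =>
    Real.arcsin_sin (Real.neg_pi_div_two_lt_arctan _).le (Real.arctan_lt_pi_div_two _).le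
  rcases x with i | q | _ | _
  · refine Tendsto.mono_left ?_ inf_le_left
    have hre : (circlePt (angle (.lower i))).re = Real.sin (Real.arctan i) := by
      simp [circlePt, angle, Real.cos_sub_pi_div_two]
    have him : (circlePt (angle (.lower i))).im = -Real.cos (Real.arctan i) := by
      simp [circlePt, angle, Real.sin_sub_pi_div_two]
    have hp := (Real.cos_arctan_pos i).ne'
    have hc := continuousAt_ofDisc (z := circlePt (angle (.lower i))) (by rwa [hre, harc])
    convert hc.tendsto using 1
    simp only [Pt.nhds, ofDisc, hre, him, harc, Real.tan_arctan, neg_div, div_self hp]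
    norm_num
  · refine Tendsto.mono_left ?_ inf_le_left
    have hre : (circlePt (angle (.upper q))).re = Real.sin (Real.arctan q) := by
      simp [circlePt, angle, Real.cos_pi_div_two_sub]
    have him : (circlePt (angle (.upper q))).im = Real.cos (Real.arctan q) := by
      simp [circlePt, angle, Real.sin_pi_div_two_sub]
    have hp := (Real.cos_arctan_pos q).ne'
    have hc := continuousAt_ofDisc (z := circlePt (angle (.upper q))) (by rwa [hre, harc])
    convert hc.tendsto using 1
    simp only [Pt.nhds, ofDisc, hre, him, harc, Real.tan_arctan, div_self hp]
    norm_num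
  · refine tendsto_comap_iff.2 (Real.tendsto_tan_neg_pi_div_two.comp ?_)
    refine tendsto_nhdsWithin_iff.2 ⟨?_, ?_⟩
    · refine Tendsto.mono_left ?_ inf_le_left
      have e : -(Real.pi / 2) = Real.arcsin (circlePt (angle .negInf)).re := by simp [circlePt, angle]
      rw [e]
      exact (Real.continuous_arcsin.comp Complex.continuous_re).tendsto _
    · exact eventually_inf_principal.2 (Eventually.of_forall fun z hz =>
        Real.neg_pi_div_two_lt_arcsin.2 (abs_re_lt_one hz).1)
  · refine tendsto_comap_iff.2 (Real.tendsto_tan_pi_div_two.comp ?_)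
    refine tendsto_nhdsWithin_iff.2 ⟨?_, ?_⟩
    · refine Tendsto.mono_left ?_ inf_le_left
      have e : Real.pi / 2 = Real.arcsin (circlePt (angle .posInf)).re := by simp [circlePt, angle]
      rw [e]
      exact (Real.continuous_arcsin.comp Complex.continuous_re).tendsto _
    · exact eventually_inf_principal.2 (Eventually.of_forall fun z hz =>
        Real.arcsin_lt_pi_div_two.2 (abs_re_lt_one hz).2)

/-! ### Compatibility of arcs as non-linking of angles -/

/-- The pairs of angles `a, b` and `c, d` separate each other. -/
def Linked (a b c d : ℝ) : Prop := (c - a) * (c - b) * ((d - a) * (d - b)) < 0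

theorem Linked.swap_left {a b c d : ℝ} (h : Linked a b c d) : Linked b a c d := by
  unfold Linked at *; linarith

theorem Linked.swap_right {a b c d : ℝ} (h : Linked a b c d) : Linked a b d c := by
  unfold Linked at *; linarith

theorem Linked.symm {a b c d : ℝ} (h : Linked a b c d) : Linked c d a b := by
  unfold Linked at *; linarith

theorem IsCurve.reverse {γ : ℝ → ℝ × ℝ} {x y : Pt} (h : IsCurve γ x y) :
    IsCurve (fun t => γ (1 - t)) y x := by
  have hm : ∀ t ∈ Ioo (0 : ℝ) 1, 1 - t ∈ Ioo (0 : ℝ) 1 := fun t ht =>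
    ⟨by linarith [ht.2], by linarith [ht.1]⟩
  have hc : Continuous fun t : ℝ => 1 - t := by fun_prop
  refine ⟨h.continuousOn.comp hc.continuousOn hm, ?_, fun t ht => h.mem_strip _ (hm t ht), ?_, ?_⟩
  · intro s hs t ht hst
    have := h.injOn (hm s hs) (hm t ht) hst
    linarith
  · refine h.tendsto_end.comp (tendsto_nhdsWithin_iff.2 ⟨?_, ?_⟩)
    · have := hc.tendsto 0
      rw [sub_zero] at this
      exact this.mono_left nhdsWithin_le_nhds
    · filter_upwards [self_mem_nhdsWithin] with t ht
      simpa using ht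
  · refine h.tendsto_start.comp (tendsto_nhdsWithin_iff.2 ⟨?_, ?_⟩)
    · have := hc.tendsto 1
      rw [sub_self] at this
      exact this.mono_left nhdsWithin_le_nhds
    · filter_upwards [self_mem_nhdsWithin] with t ht
      simpa using ht

theorem image_reverse (γ : ℝ → ℝ × ℝ) :
    (fun t => γ (1 - t)) '' Ioo (0 : ℝ) 1 = γ '' Ioo (0 : ℝ) 1 := by
  have : (fun t => γ (1 - t)) = γ ∘ fun t => 1 - t := rfl
  rw [this, image_comp, image_const_sub_Ioo]
  norm_num

theorem Represents.exists_isCurve {γ : ℝ → ℝ × ℝ} {x y : Pt} (h : Represents γ s(x, y)) :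
    ∃ δ, IsCurve δ x y ∧ δ '' Ioo (0 : ℝ) 1 = γ '' Ioo (0 : ℝ) 1 := by
  obtain ⟨u, v, e, hc⟩ := h
  rcases Sym2.eq_iff.1 e with ⟨rfl, rfl⟩ | ⟨rfl, rfl⟩
  · exact ⟨γ, hc, rfl⟩
  · exact ⟨_, hc.reverse, image_reverse γ⟩

theorem compatible_iff {x y u v : Pt} : Compatible s(x, y) s(u, v) ↔
    ∃ γ δ : ℝ → ℝ × ℝ, IsCurve γ x y ∧ IsCurve δ u v ∧
      Disjoint (γ '' Ioo 0 1) (δ '' Ioo 0 1) := by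
  constructor
  · rintro ⟨γ, δ, hγ, hδ, hd⟩
    obtain ⟨γ', h1, h2⟩ := hγ.exists_isCurve
    obtain ⟨δ', h3, h4⟩ := hδ.exists_isCurve
    exact ⟨γ', δ', h1, h3, by rwa [h2, h4]⟩
  · rintro ⟨γ, δ, hγ, hδ, hd⟩
    exact ⟨γ, δ, ⟨x, y, rfl, hγ⟩, ⟨u, v, rfl, hδ⟩, hd⟩

theorem IsCurve.exists_disc_curve {γ : ℝ → ℝ × ℝ} {x y : Pt} (h : IsCurve γ x y) :
    ∃ g : ℝ → ℂ, ContinuousOn g (Icc 0 1) ∧ g 0 = circlePt (angle x) ∧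
      g 1 = circlePt (angle y) ∧ ∀ t ∈ Ioo (0 : ℝ) 1, g t = toDisc (γ t) := by
  have hev0 : ∀ᶠ t in 𝓝[>] (0 : ℝ), (γ t).2 ∈ Ioo (0 : ℝ) 1 := by
    filter_upwards [Ioo_mem_nhdsGT (zero_lt_one' ℝ)] with t ht using h.mem_strip t ht
  have hev1 : ∀ᶠ t in 𝓝[<] (1 : ℝ), (γ t).2 ∈ Ioo (0 : ℝ) 1 := by
    filter_upwards [Ioo_mem_nhdsLT (zero_lt_one' ℝ)] with t ht using h.mem_strip t ht
  have h0 : Tendsto (toDisc ∘ γ) (𝓝[>] 0) (𝓝 (circlePt (angle x))) :=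
    (tendsto_toDisc x).comp (tendsto_inf.2 ⟨h.tendsto_start, tendsto_principal.2 hev0⟩)
  have h1 : Tendsto (toDisc ∘ γ) (𝓝[<] 1) (𝓝 (circlePt (angle y))) :=
    (tendsto_toDisc y).comp (tendsto_inf.2 ⟨h.tendsto_end, tendsto_principal.2 hev1⟩)
  have hc : ContinuousOn (toDisc ∘ γ) (Ioo 0 1) := continuous_toDisc.comp_continuousOn h.continuousOn
  refine ⟨extendFrom (Ioo 0 1) (toDisc ∘ γ), continuousOn_Icc_extendFrom_Ioo hc h0 h1,
    eq_lim_at_left_extendFrom_Ioo zero_lt_one h0, eq_lim_at_right_extendFrom_Ioo zero_lt_one h1,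
    fun t ht => extendFrom_extends hc t ht⟩

theorem not_compatible_of_lt {x y u v : Pt} (h1 : angle x < angle u) (h2 : angle u < angle y)
    (h3 : angle v < angle x ∨ angle y < angle v) : ¬ Compatible s(x, y) s(u, v) := by
  rw [compatible_iff]
  rintro ⟨γ, δ, hγ, hδ, hd⟩
  obtain ⟨g, gc, g0, g1, ge⟩ := hγ.exists_disc_curve
  obtain ⟨h, hc, h0, h1', he⟩ := hδ.exists_disc_curve
  have gn : ∀ t ∈ Ioo (0 : ℝ) 1, ‖g t‖ < 1 := fun t ht => by
    rw [ge t ht]; exact norm_toDisc_lt_one (hγ.mem_strip t ht)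
  have hn : ∀ t ∈ Ioo (0 : ℝ) 1, ‖h t‖ < 1 := fun t ht => by
    rw [he t ht]; exact norm_toDisc_lt_one (hδ.mem_strip t ht)
  have hx := neg_pi_le_angle x
  have hv := neg_pi_le_angle v
  have hv' := angle_lt_pi v
  have hy' := angle_lt_pi y
  obtain ⟨s, hs, t, ht, hst⟩ : ∃ s ∈ Ioo (0 : ℝ) 1, ∃ t ∈ Ioo (0 : ℝ) 1, g s = h t := by
    -- If `v` precedes `x`, the angle of `v` plus 2π names the same point and completes the cyclic
    -- order.
    rcases h3 with h3 | h3
    · exact exists_eq_of_linked_in_disc gc hc gn hn g0 g1 h0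
        (h1'.trans (circlePt_add_two_pi _).symm) h1 h2 (by linarith) (by linarith)
    · exact exists_eq_of_linked_in_disc gc hc gn hn g0 g1 h0 h1' h1 h2 h3 (by linarith)
  rw [ge s hs, he t ht] at hst
  exact hd.ne_of_mem (mem_image_of_mem γ hs) (mem_image_of_mem δ ht) (toDisc_injective hst)

theorem not_compatible_of_linked {x y u v : Pt}
    (h : Linked (angle x) (angle y) (angle u) (angle v)) : ¬ Compatible s(x, y) s(u, v) := by
  wlog hxy : angle x ≤ angle y generalizing x y
  · rw [Sym2.eq_swap (a := x)]
    exact this h.swap_left (not_le.1 hxy).le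
  wlog huv : (angle u - angle x) * (angle u - angle y) < 0 generalizing u v
  · rw [Sym2.eq_swap (a := u)]
    refine this h.swap_right ?_
    rcases mul_neg_iff.1 h with h | h
    · exact h.2
    · exact absurd h.1 huv
  have hv : 0 < (angle v - angle x) * (angle v - angle y) := by
    rcases mul_neg_iff.1 h with h | h
    · exact absurd h.1 (not_lt.2 huv.le)
    · exact h.2
  have hu : angle x < angle u ∧ angle u < angle y := by
    rcases mul_neg_iff.1 huv with h | h <;> constructor <;> linarith
  refine not_compatible_of_lt hu.1 hu.2 ?_
  rcases mul_pos_iff.1 hv with h | h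
  · right; linarith
  · left; linarith

/-- The affine functional that vanishes on the chord between the angles `a` and `b`. -/
noncomputable def chordForm (a b : ℝ) (z : ℂ) : ℝ :=
  z.re * Real.cos ((a + b) / 2) + z.im * Real.sin ((a + b) / 2) - Real.cos ((a - b) / 2)

theorem chordForm_circlePt (a b c : ℝ) :
    chordForm a b (circlePt c) = -2 * Real.sin ((c - a) / 2) * Real.sin ((c - b) / 2) := by
  have : chordForm a b (circlePt c) = Real.cos (c - (a + b) / 2) - Real.cos ((a - b) / 2) := by
    simp only [chordForm, circlePt, Real.cos_sub c]
  rw [this, Real.cos_sub_cos]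
  rw [show (c - (a + b) / 2 + (a - b) / 2) / 2 = (c - b) / 2 by ring,
    show (c - (a + b) / 2 - (a - b) / 2) / 2 = (c - a) / 2 by ring]
  ring

/-- The point with parameter `t` of the chord between the angles `a` and `b`. -/
noncomputable def chord (a b t : ℝ) : ℂ := (1 - t : ℝ) * circlePt a + (t : ℝ) * circlePt b

theorem chordForm_chord (a b c d t : ℝ) : chordForm a b (chord c d t) =
    (1 - t) * chordForm a b (circlePt c) + t * chordForm a b (circlePt d) := by
  simp only [chordForm, chord, Complex.add_re, Complex.add_im, Complex.re_ofReal_mul,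
    Complex.im_ofReal_mul]
  ring

theorem continuous_chord (a b : ℝ) : Continuous (chord a b) := by
  unfold chord; fun_prop

theorem norm_chord_lt_one {a b : ℝ} (h : circlePt a ≠ circlePt b) {t : ℝ}
    (ht : t ∈ Ioo (0 : ℝ) 1) : ‖chord a b t‖ < 1 := by
  have := dot_circlePt_lt_one (z := circlePt b) (norm_circlePt b).le h.symm
  have ha := Real.sin_sq_add_cos_sq a
  have hb := Real.sin_sq_add_cos_sq b
  have hp : 0 < t * (1 - t) := mul_pos ht.1 (by linarith [ht.2])
  rw [norm_lt_one_iff]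
  simp only [chord, circlePt, Complex.add_re, Complex.add_im, Complex.re_ofReal_mul,
    Complex.im_ofReal_mul] at *
  have e : ((1 - t) * Real.cos a + t * Real.cos b) ^ 2 + ((1 - t) * Real.sin a + t * Real.sin b) ^ 2
    = (1 - t) ^ 2 * (Real.sin a ^ 2 + Real.cos a ^ 2) + t ^ 2 * (Real.sin b ^ 2 + Real.cos b ^ 2)
      + 2 * (t * (1 - t)) * (Real.cos b * Real.cos a + Real.sin b * Real.sin a) := by ring
  rw [e, ha, hb]
  nlinarith

theorem circlePt_angle_injective : Function.Injective fun x => circlePt (angle x) := by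
  intro x y h
  by_contra hne
  have hx := neg_pi_le_angle x
  have hy := neg_pi_le_angle y
  have hx' := angle_lt_pi x
  have hy' := angle_lt_pi y
  rcases lt_or_gt_of_ne (angle_injective.ne hne) with h' | h'
  · exact circlePt_ne h' (by linarith) h
  · exact circlePt_ne h' (by linarith) h.symm

theorem isCurve_chord {x y : Pt} (h : x ≠ y) :
    IsCurve (fun t => ofDisc (chord (angle x) (angle y) t)) x y := by
  have hne : circlePt (angle x) ≠ circlePt (angle y) := circlePt_angle_injective.ne h
  have hn := fun t ht => norm_chord_lt_one hne (t := t) ht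
  refine ⟨?_, ?_, fun t ht => ofDisc_mem_strip (hn t ht), ?_, ?_⟩
  · intro t ht
    exact ((continuousAt_ofDisc (cos_arcsin_pos (hn t ht)).ne').comp
      (continuous_chord _ _).continuousAt).continuousWithinAt
  · intro s hs t ht hst
    have := congrArg toDisc hst
    simp only [toDisc_ofDisc (hn s hs), toDisc_ofDisc (hn t ht)] at this
    have e : ((s - t : ℝ) : ℂ) * (circlePt (angle y) - circlePt (angle x)) = 0 := by
      rw [← sub_eq_zero] at this
      rw [← this]; simp only [chord]; push_cast; ring
    rcases mul_eq_zero.1 e with e | e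
    · linarith [Complex.ofReal_eq_zero.1 e]
    · exact absurd (sub_eq_zero.1 e).symm hne
  · refine (tendsto_ofDisc x).comp (tendsto_inf.2 ⟨?_, tendsto_principal.2 ?_⟩)
    · have := (continuous_chord (angle x) (angle y)).tendsto 0
      simp only [chord, sub_zero, Complex.ofReal_one, one_mul, Complex.ofReal_zero, zero_mul,
        add_zero] at this
      exact this.mono_left nhdsWithin_le_nhds
    · filter_upwards [Ioo_mem_nhdsGT (zero_lt_one' ℝ)] with t ht using hn t ht
  · refine (tendsto_ofDisc y).comp (tendsto_inf.2 ⟨?_, tendsto_principal.2 ?_⟩)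
    · have := (continuous_chord (angle x) (angle y)).tendsto 1
      simp only [chord, sub_self, Complex.ofReal_one, one_mul, Complex.ofReal_zero, zero_mul,
        zero_add] at this
      exact this.mono_left nhdsWithin_le_nhds
    · filter_upwards [Ioo_mem_nhdsLT (zero_lt_one' ℝ)] with t ht using hn t ht

/-- Half the difference of two angles in [-π, π) lies in (-π, π), where the sine has the sign of its
argument. -/
theorem sign_chordForm (x y u : Pt) :
    (0 < (angle u - angle x) * (angle u - angle y) →
      chordForm (angle x) (angle y) (circlePt (angle u)) < 0) ∧
    ((angle u - angle x) * (angle u - angle y) < 0 →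
      0 < chordForm (angle x) (angle y) (circlePt (angle u))) ∧
    ((angle u - angle x) * (angle u - angle y) = 0 →
      chordForm (angle x) (angle y) (circlePt (angle u)) = 0) := by
  have spos : ∀ v w : Pt, 0 < angle v - angle w → 0 < Real.sin ((angle v - angle w) / 2) :=
    fun v w h => Real.sin_pos_of_pos_of_lt_pi (by linarith)
      (by linarith [angle_lt_pi v, neg_pi_le_angle w])
  have sneg : ∀ v w : Pt, angle v - angle w < 0 → Real.sin ((angle v - angle w) / 2) < 0 :=
    fun v w h => Real.sin_neg_of_neg_of_neg_pi_lt (by linarith)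
      (by linarith [angle_lt_pi w, neg_pi_le_angle v])
  rw [chordForm_circlePt, mul_assoc]
  refine ⟨fun h => ?_, fun h => ?_, fun h => ?_⟩
  · have : 0 < Real.sin ((angle u - angle x) / 2) * Real.sin ((angle u - angle y) / 2) := by
      rcases mul_pos_iff.1 h with h | h
      · exact mul_pos (spos _ _ h.1) (spos _ _ h.2)
      · exact mul_pos_of_neg_of_neg (sneg _ _ h.1) (sneg _ _ h.2)
    linarith
  · have : Real.sin ((angle u - angle x) / 2) * Real.sin ((angle u - angle y) / 2) < 0 := by
      rcases mul_neg_iff.1 h with h | h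
      · exact mul_neg_of_pos_of_neg (spos _ _ h.1) (sneg _ _ h.2)
      · exact mul_neg_of_neg_of_pos (sneg _ _ h.1) (spos _ _ h.2)
    linarith
  · rcases mul_eq_zero.1 h with h | h <;> simp [h]

theorem compatible_of_not_linked {x y u v : Pt} (hxy : x ≠ y) (huv : u ≠ v)
    (hne : s(x, y) ≠ s(u, v)) (h : ¬ Linked (angle x) (angle y) (angle u) (angle v)) :
    Compatible s(x, y) s(u, v) := by
  rw [compatible_iff]
  refine ⟨_, _, isCurve_chord hxy, isCurve_chord huv, ?_⟩
  rw [disjoint_left]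
  rintro _ ⟨s, hs, rfl⟩ ⟨t, ht, hst⟩
  have e := congrArg toDisc hst
  simp only [toDisc_ofDisc (norm_chord_lt_one (circlePt_angle_injective.ne hxy) hs),
    toDisc_ofDisc (norm_chord_lt_one (circlePt_angle_injective.ne huv) ht)] at e
  have e' := congrArg (chordForm (angle x) (angle y)) e
  rw [chordForm_chord, chordForm_chord, (sign_chordForm x y x).2.2 (by simp),
    (sign_chordForm x y y).2.2 (by simp)] at e'
  obtain ⟨u1, u2, u3⟩ := sign_chordForm x y u
  obtain ⟨v1, v2, v3⟩ := sign_chordForm x y v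
  have ht0 := ht.1
  have ht1 : 0 < 1 - t := by linarith [ht.2]
  have hz : ∀ w : Pt, (angle w - angle x) * (angle w - angle y) = 0 → w = x ∨ w = y := fun w hw => by
    rcases mul_eq_zero.1 hw with hw | hw
    · exact Or.inl (angle_injective (sub_eq_zero.1 hw))
    · exact Or.inr (angle_injective (sub_eq_zero.1 hw))
  unfold Linked at h
  -- At a common point, a combination with positive weights of the values of `chordForm` at `u` and
  -- `v` vanishes. Either the values have opposite signs, so the pairs are linked, or both vanish,
  -- so the pairs coincide.
  rcases lt_trichotomy ((angle u - angle x) * (angle u - angle y)) 0 with hu | hu | hu <;>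
    rcases lt_trichotomy ((angle v - angle x) * (angle v - angle y)) 0 with hv | hv | hv
  · nlinarith [u2 hu, v2 hv]
  · nlinarith [u2 hu, v3 hv]
  · exact h (mul_neg_of_neg_of_pos hu hv)
  · nlinarith [u3 hu, v2 hv]
  · rcases hz u hu with rfl | rfl <;> rcases hz v hv with rfl | rfl
    · exact huv rfl
    · exact hne rfl
    · exact hne Sym2.eq_swap
    · exact huv rfl
  · nlinarith [u3 hu, v1 hv]
  · exact h (mul_neg_of_pos_of_neg hu hv)
  · nlinarith [u1 hu, v3 hv]
  · nlinarith [u1 hu, v1 hv]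

end Strip

/-! ### Linear recurrences in a frieze -/

namespace IsInfiniteFrieze

variable {m : ℤ → ℤ → ℤ}

theorem pos' (hm : IsInfiniteFrieze m) {i j : ℤ} (h : i - 1 ≤ j) : 0 < m i j := by
  rcases eq_or_lt_of_le h with rfl | h
  · rw [hm.one_row]; exact one_pos
  · exact hm.pos i j (by omega)

/-- Subtracting the unimodular rules of two adjacent diamonds shows that the ratio of the outer sum
to the middle entry is the same for neighbouring first indices. The border of 0s and 1s gives its
value, and positivity permits the cancellation. -/
theorem row_recurrence (hm : IsInfiniteFrieze m) (j : ℤ) (n : ℕ) :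
    m (j + 1 - n) (j + 1) + m (j + 1 - n) (j - 1) = m (j + 1) (j + 1) * m (j + 1 - n) j := by
  induction n with
  | zero =>
    have h1 := hm.zero_row (j + 1)
    have h2 := hm.one_row (j + 1)
    rw [show j + 1 - 2 = j - 1 by ring] at h1
    rw [show j + 1 - 1 = j by ring] at h2
    simp [h1, h2]
  | succ n ih =>
    have h1 := hm.unimodular (j + 1 - (n + 1 : ℕ)) j (by push_cast; omega)
    have h2 := hm.unimodular (j + 1 - (n + 1 : ℕ)) (j - 1) (by push_cast; omega)
    rw [show j + 1 - ((n + 1 : ℕ) : ℤ) + 1 = j + 1 - n by push_cast; ring] at h1 h2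
    rw [show j - 1 + 1 = j by ring] at h2
    have hp : 0 < m (j + 1 - n) j := hm.pos' (by omega)
    apply mul_left_cancel₀ hp.ne'
    linear_combination h2 - h1 + m (j + 1 - (n + 1 : ℕ)) j * ih

theorem column_recurrence (hm : IsInfiniteFrieze m) (i : ℤ) (n : ℕ) :
    m (i - 1) (i - 1 + n) + m (i + 1) (i - 1 + n) = m (i - 1) (i - 1) * m i (i - 1 + n) := by
  induction n with
  | zero =>
    have h1 := hm.zero_row (i + 1)
    have h2 := hm.one_row i
    rw [show i + 1 - 2 = i - 1 by ring] at h1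
    simp [h1, h2]
  | succ n ih =>
    have h1 := hm.unimodular (i - 1) (i - 1 + n) (by omega)
    have h2 := hm.unimodular i (i - 1 + n) (by omega)
    rw [show i - 1 + 1 = i by ring] at h1
    rw [show i - 1 + ((n + 1 : ℕ) : ℤ) = i - 1 + n + 1 by push_cast; ring]
    have hp : 0 < m i (i - 1 + n) := hm.pos' (by omega)
    apply mul_left_cancel₀ hp.ne'
    linear_combination h2 - h1 + m i (i - 1 + n + 1) * ih

end IsInfiniteFrieze

/-! ### Frieze entries as determinants of lattice vectors -/

namespace Strip

/-- The determinant of two vectors in the plane. -/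
def det (v w : ℤ × ℤ) : ℤ := v.1 * w.2 - v.2 * w.1

theorem det_swap (v w : ℤ × ℤ) : det w v = -det v w := by unfold det; ring

/-- The entries of a frieze, extended to an antisymmetric array. -/
def entry (m : ℤ → ℤ → ℤ) (i j : ℤ) : ℤ :=
  if i ≤ j then m (i + 1) (j - 1) else -m (j + 1) (i - 1)

/-- The vectors whose pairwise determinants are the entries of the frieze. -/
def friezeVec (m : ℤ → ℤ → ℤ) (j : ℤ) : ℤ × ℤ := (entry m j 1, entry m 0 j)

variable {m : ℤ → ℤ → ℤ}

theorem entry_self (hm : IsInfiniteFrieze m) (i : ℤ) : entry m i i = 0 := by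
  have := hm.zero_row (i + 1)
  rw [show i + 1 - 2 = i - 1 by ring] at this
  simp [entry, this]

theorem entry_swap (hm : IsInfiniteFrieze m) (i j : ℤ) : entry m j i = -entry m i j := by
  rcases lt_trichotomy i j with h | rfl | h
  · simp [entry, h.le, not_le.2 h]
  · simp [entry_self hm]
  · simp [entry, h.le, not_le.2 h]

theorem entry_succ (hm : IsInfiniteFrieze m) (i : ℤ) : entry m i (i + 1) = 1 := by
  have := hm.one_row (i + 1)
  rw [show i + 1 - 1 = i by ring] at this
  simp [entry, this]

theorem entry_pos (hm : IsInfiniteFrieze m) {i j : ℤ} (h : i < j) : 0 < entry m i j := by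
  rw [entry, if_pos h.le]
  exact hm.pos' (by omega)

theorem entry_recurrence (hm : IsInfiniteFrieze m) (i j : ℤ) :
    entry m i (j + 1) + entry m i (j - 1) = m j j * entry m i j := by
  rcases lt_trichotomy i j with h | rfl | h
  · have := hm.row_recurrence (j - 1) (j - 1 - i).toNat
    rw [Int.toNat_of_nonneg (by omega), show j - 1 + 1 - (j - 1 - i) = i + 1 by ring,
      show j - 1 + 1 = j by ring] at this
    rw [entry, entry, entry, if_pos (by omega), if_pos (by omega), if_pos h.le,
      show j + 1 - 1 = j by ring]
    exact this
  · rw [entry_swap hm (i - 1) i, entry_succ hm i, entry_self hm]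
    have := entry_succ hm (i - 1)
    rw [sub_add_cancel] at this
    rw [this]; ring
  · have := hm.column_recurrence (j + 1) (i - 1 - j).toNat
    rw [Int.toNat_of_nonneg (by omega), show j + 1 - 1 + (i - 1 - j) = i - 1 by ring,
      show j + 1 - 1 = j by ring] at this
    rw [entry_swap hm (j + 1) i, entry_swap hm (j - 1) i, entry_swap hm j i,
      entry, entry, entry, if_pos (by omega), if_pos (by omega), if_pos h.le,
      show j - 1 + 1 = j by ring]
    linarith

theorem friezeVec_zero (hm : IsInfiniteFrieze m) : friezeVec m 0 = (1, 0) := by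
  have := entry_succ hm 0
  rw [zero_add] at this
  simp [friezeVec, this, entry_self hm]

/-- A solution of a linear recurrence on the integers that vanishes at `0` and `1` is zero. -/
theorem eq_zero_of_recurrence {f a : ℤ → ℤ} (h : ∀ j, f (j + 1) + f (j - 1) = a j * f j)
    (h0 : f 0 = 0) (h1 : f 1 = 0) (j : ℤ) : f j = 0 := by
  suffices f j = 0 ∧ f (j + 1) = 0 from this.1
  induction j using Int.induction_on with
  | zero => exact ⟨h0, by simpa using h1⟩
  | succ n ih =>
    refine ⟨ih.2, ?_⟩
    have := h (n + 1)
    rw [show (n : ℤ) + 1 - 1 = n by ring, ih.1, ih.2] at this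
    linarith
  | pred n ih =>
    have := h (-n)
    rw [ih.1, ih.2] at this
    exact ⟨by linarith, by rw [sub_add_cancel]; exact ih.1⟩

theorem det_friezeVec (hm : IsInfiniteFrieze m) (i j : ℤ) :
    det (friezeVec m i) (friezeVec m j) = entry m i j := by
  rw [← sub_eq_zero]
  have key : ∀ i, (det (friezeVec m i) (friezeVec m j) - entry m i j) = 0 := by
    -- In the first index both terms satisfy the frieze recurrence, and they agree at 0 and 1, where
    -- the frieze vectors are the standard basis.
    refine eq_zero_of_recurrence (a := fun i => m i i) (fun i => ?_) ?_ ?_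
    · have h1 := entry_recurrence hm 1 i
      have h2 := entry_recurrence hm 0 i
      have h3 := entry_recurrence hm j i
      simp only [det, friezeVec]
      rw [entry_swap hm 1 (i + 1), entry_swap hm 1 (i - 1), entry_swap hm 1 i,
        entry_swap hm j (i + 1), entry_swap hm j (i - 1), entry_swap hm j i]
      linear_combination (- entry m 0 j) * h1 - (entry m j 1) * h2 + h3
    · rw [friezeVec_zero hm]; simp [det, friezeVec]
    · have := entry_succ hm 0
      rw [zero_add] at this
      simp only [det, friezeVec, entry_self hm, this]
      rw [entry_swap hm 1 j]; ring
  exact key i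

theorem friezeVec_add (hm : IsInfiniteFrieze m) (j : ℤ) :
    friezeVec m (j + 1) = m j j • friezeVec m j - friezeVec m (j - 1) := by
  have h1 := entry_recurrence hm 1 j
  have h2 := entry_recurrence hm 0 j
  simp only [friezeVec]
  rw [entry_swap hm 1 (j + 1), entry_swap hm 1 (j - 1), entry_swap hm 1 j]
  ext
  · simp only [Prod.fst_sub, Prod.smul_fst, smul_eq_mul]; linarith
  · simp only [Prod.snd_sub, Prod.smul_snd, smul_eq_mul]; linarith

end Strip

/-! ### Triangulations and fans at a lower marked point -/

namespace Strip

/-- An arc of `T` or a boundary segment. -/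
def IsSide (A : Set ℚ) (T : Set (Sym2 Pt)) (e : Sym2 Pt) : Prop := e ∈ T ∨ IsBoundarySegment A e

/-- Zorn's lemma applies because compatibility concerns two arcs at a time and so passes to unions
of chains. -/
theorem exists_triangulation_superset {A : Set ℚ} {S : Set (Sym2 Pt)} (h1 : ∀ e ∈ S, IsArc A e)
    (h2 : S.Pairwise Compatible) : ∃ T, S ⊆ T ∧ IsTriangulation A T := by
  refine zorn_subset_nonempty {S | (∀ e ∈ S, IsArc A e) ∧ S.Pairwise Compatible} ?_ S ⟨h1, h2⟩
  intro c hc hch _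
  refine ⟨⋃₀ c, ⟨?_, ?_⟩, fun s hs => subset_sUnion_of_mem hs⟩
  · rintro e ⟨s, hs, he⟩
    exact (hc hs).1 e he
  · exact (pairwise_sUnion hch.directedOn).2 fun s hs => (hc hs).2

theorem IsBoundarySegment.available {A : Set ℚ} {e : Sym2 Pt} (h : IsBoundarySegment A e) :
    ∀ x ∈ e, x.Available A := by
  rcases h with ⟨i, rfl⟩ | ⟨p, hp, q, hq, -, -, rfl⟩ <;> intro x hx <;>
    rcases Sym2.mem_iff.1 hx with rfl | rfl
  · trivial
  · trivial
  · exact hp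
  · exact hq

/-- No available point lies between the end points of a boundary segment. -/
theorem IsBoundarySegment.nonneg {A : Set ℚ} {x y w : Pt} (h : IsBoundarySegment A s(x, y))
    (hw : w.Available A) : 0 ≤ (angle w - angle x) * (angle w - angle y) := by
  have hpi := Real.pi_pos
  suffices ∀ u v : Pt, s(x, y) = s(u, v) → angle w ≤ angle u ∧ angle w ≤ angle v ∨
      angle u ≤ angle w ∧ angle v ≤ angle w →
      0 ≤ (angle w - angle x) * (angle w - angle y) by
    rcases h with ⟨i, e⟩ | ⟨p, hp, q, hq, hpq, hr, e⟩
    · refine this _ _ e ?_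
      have h1 := angle_lower_neg i
      have h2 := angle_lower_neg (i + 1)
      have h3 := neg_pi_le_angle (.lower i)
      have h4 := neg_pi_le_angle (.lower (i + 1))
      rcases w with j | r | _ | _
      · simp only [← not_lt, angle_lower_lt]; omega
      · have := angle_upper_pos r
        right; constructor <;> linarith
      · exact Or.inl ⟨h3, h4⟩
      · exact Or.inr ⟨h1.le, h2.le⟩
    · refine this _ _ e ?_
      have h1 := angle_upper_pos p
      have h2 := angle_upper_pos q
      rcases w with j | r | _ | _
      · have := angle_lower_neg j
        left; constructor <;> linarith
      · have := hr r hw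
        simp only [← not_lt, angle_upper_lt]
        by_cases hpr : p < r
        · exact Or.inl ⟨hpr.le.not_gt, fun h => this ⟨hpr, h⟩⟩
        · exact Or.inr ⟨hpr, fun h => hpr (hpq.trans h)⟩
      · exact Or.inl ⟨neg_pi_le_angle _, neg_pi_le_angle _⟩
      · exact Or.inl ⟨h1.le, h2.le⟩
  rintro u v e h
  have : 0 ≤ (angle w - angle u) * (angle w - angle v) := by
    rcases h with h | h
    · exact mul_nonneg_of_nonpos_of_nonpos (by linarith) (by linarith)
    · exact mul_nonneg (by linarith) (by linarith)
  rcases Sym2.eq_iff.1 e with ⟨rfl, rfl⟩ | ⟨rfl, rfl⟩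
  · exact this
  · rwa [mul_comm]

theorem IsSide.available {A : Set ℚ} {T : Set (Sym2 Pt)} (hT : IsTriangulation A T) {e : Sym2 Pt}
    (h : IsSide A T e) : ∀ x ∈ e, x.Available A :=
  h.elim (fun h => (hT.prop.1 e h).2.1) fun h => h.available

/-- Distinct arcs of `T` are compatible, and a boundary segment never separates available points. -/
theorem IsSide.not_linked {A : Set ℚ} {T : Set (Sym2 Pt)} (hT : IsTriangulation A T)
    {x y u v : Pt} (h : IsSide A T s(x, y)) (h' : IsSide A T s(u, v)) :
    ¬ Linked (angle x) (angle y) (angle u) (angle v) := by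
  intro hl
  have hx := h.available hT x (Sym2.mem_mk_left _ _)
  have hy := h.available hT y (Sym2.mem_mk_right _ _)
  have hu := h'.available hT u (Sym2.mem_mk_left _ _)
  have hv := h'.available hT v (Sym2.mem_mk_right _ _)
  rcases h with h | h
  · rcases h' with h' | h'
    · by_cases he : s(x, y) = s(u, v)
      · unfold Linked at hl
        rcases Sym2.eq_iff.1 he with ⟨rfl, rfl⟩ | ⟨rfl, rfl⟩ <;> simp at hl
      · exact not_compatible_of_linked hl (hT.prop.2 h h' he)
    · exact absurd hl.symm (not_lt.2 (mul_nonneg (h'.nonneg hx) (h'.nonneg hy)))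
  · exact absurd hl (not_lt.2 (mul_nonneg (h.nonneg hu) (h.nonneg hv)))

/-- The position of `y` on the circle, seen from `x` in counterclockwise direction. -/
noncomputable def cyclicPos (x y : Pt) : ℝ :=
  if angle x < angle y then angle y else angle y + 2 * Real.pi

theorem cyclicPos_injective (x : Pt) : Function.Injective (cyclicPos x) := by
  intro y z h
  have := neg_pi_le_angle y
  have := neg_pi_le_angle z
  have := angle_lt_pi y
  have := angle_lt_pi z
  unfold cyclicPos at h
  apply angle_injective
  split_ifs at h <;> linarith

/-- Seen from `x`, the point `y` comes between `u` and `v`, so the chord from `x` to `y` separates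
them. -/
theorem linked_of_cyclicPos_lt {x y u v : Pt} (hy : y ≠ x) (hu : u ≠ x) (hv : v ≠ x)
    (h1 : cyclicPos x u < cyclicPos x y) (h2 : cyclicPos x y < cyclicPos x v) :
    Linked (angle x) (angle y) (angle u) (angle v) := by
  have := neg_pi_le_angle y
  have := neg_pi_le_angle u
  have := neg_pi_le_angle v
  have := angle_lt_pi y
  have := angle_lt_pi u
  have := angle_lt_pi v
  have hy' := angle_injective.ne hy
  have hu' := angle_injective.ne hu
  have hv' := angle_injective.ne hv
  unfold cyclicPos at h1 h2
  rcases lt_or_gt_of_ne hy' with cy | cy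
  · rw [if_neg cy.not_gt] at h1 h2
    have cv : angle v < angle x := by
      rcases lt_or_gt_of_ne hv' with cv | cv
      · exact cv
      · rw [if_pos cv] at h2; linarith
    rw [if_neg cv.not_gt] at h2
    have hv0 : (angle v - angle x) * (angle v - angle y) < 0 :=
      mul_neg_of_neg_of_pos (by linarith) (by linarith)
    refine mul_neg_of_pos_of_neg ?_ hv0
    rcases lt_or_gt_of_ne hu' with cu | cu
    · rw [if_neg cu.not_gt] at h1
      exact mul_pos_of_neg_of_neg (by linarith) (by linarith)
    · exact mul_pos (by linarith) (by linarith)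
  · rw [if_pos cy] at h1 h2
    have cu : angle x < angle u := by
      rcases lt_or_gt_of_ne hu' with cu | cu
      · rw [if_neg cu.not_gt] at h1; linarith
      · exact cu
    rw [if_pos cu] at h1
    have hu0 : (angle u - angle x) * (angle u - angle y) < 0 :=
      mul_neg_of_pos_of_neg (by linarith) (by linarith)
    refine mul_neg_of_neg_of_pos hu0 ?_
    rcases lt_or_gt_of_ne hv' with cv | cv
    · exact mul_pos_of_neg_of_neg (by linarith) (by linarith)
    · rw [if_pos cv] at h2
      exact mul_pos (by linarith) (by linarith)

/-- In a triangulation, let `x 0, …, x a` be neighbours of `(i, 0)` in clockwise order from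
`(i - 1, 0)` to `(i + 1, 0)` such that consecutive ones are joined by sides. Then there are no
other neighbours, and exactly `a` triangles are incident with `(i, 0)`. -/
theorem triangles_of_fan {A : Set ℚ} {T : Set (Sym2 Pt)} (hT : IsTriangulation A T) (i : ℤ)
    (a : ℕ) (x : ℕ → Pt) (x0 : x 0 = .lower (i - 1)) (xa : x a = .lower (i + 1))
    (hne : ∀ k ≤ a, x k ≠ .lower i)
    (hanti : ∀ k l, k < l → l ≤ a → cyclicPos (.lower i) (x l) < cyclicPos (.lower i) (x k))
    (hspoke : ∀ k ≤ a, IsSide A T s(.lower i, x k))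
    (hrim : ∀ k < a, IsSide A T s(x k, x (k + 1))) :
    {e ∈ T | Pt.lower i ∈ e}.Finite ∧ (trianglesAt A T i).Finite ∧
      (trianglesAt A T i).ncard = a := by
  classical
  have hpi := Real.pi_pos
  have xinj : ∀ k ≤ a, ∀ l ≤ a, x k = x l → k = l := by
    intro k hk l hl e
    rcases lt_trichotomy k l with h | h | h
    · exact absurd (hanti k l h hl) (by rw [e]; exact lt_irrefl _)
    · exact h
    · exact absurd (hanti l k h hk) (by rw [e]; exact lt_irrefl _)
  -- A neighbour `y` outside the fan cannot come after `x 0`, by the boundary segment to `(i - 1,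
  -- 0)`. It then has to precede every `x k`, since otherwise its spoke crosses a rim; but nothing
  -- precedes `x a`.
  have nbr : ∀ y, y ≠ .lower i → IsSide A T s(.lower i, y) → ∃ k ≤ a, y = x k := by
    intro y hy hs
    by_contra! hcon
    have hav := hs.available hT y (Sym2.mem_mk_right _ _)
    have hle : ∀ k ≤ a, cyclicPos (.lower i) y ≤ cyclicPos (.lower i) (x k) := by
      intro k
      induction k with
      | zero =>
        intro _
        have hb : IsBoundarySegment A s(.lower (i - 1), .lower i) :=
          Or.inl ⟨i - 1, by rw [sub_add_cancel]⟩
        have hn := hb.nonneg hav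
        have h1 : angle (.lower (i - 1)) < angle (.lower i) := angle_lower_lt.2 (by omega)
        have h2 := neg_pi_le_angle (.lower (i - 1))
        have h3 := angle_lt_pi y
        rw [x0]
        unfold cyclicPos
        rw [if_neg (not_lt.2 h1.le)]
        split_ifs with h
        · linarith
        · have h' : angle y < angle (.lower i) := lt_of_le_of_ne (not_lt.1 h) (angle_injective.ne hy)
          have : angle y - angle (.lower (i - 1)) ≤ 0 := by
            by_contra hc
            exact absurd hn (not_le.2 (mul_neg_of_pos_of_neg (not_le.1 hc) (by linarith)))
          linarith
      | succ k ih =>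
        intro hk
        by_contra hc
        refine hs.not_linked hT (hrim k (by omega)) (Linked.swap_right ?_)
        exact linked_of_cyclicPos_lt hy (hne _ hk) (hne k (by omega)) (not_le.1 hc)
          (lt_of_le_of_ne (ih (by omega)) ((cyclicPos_injective _).ne (hcon k (by omega))))
    have hge : cyclicPos (.lower i) (x a) ≤ cyclicPos (.lower i) y := by
      have hb : IsBoundarySegment A s(.lower i, .lower (i + 1)) := Or.inl ⟨i, rfl⟩
      have hn := hb.nonneg hav
      have h1 : angle (.lower i) < angle (.lower (i + 1)) := angle_lower_lt.2 (by omega)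
      have h2 := neg_pi_le_angle y
      have h3 := angle_lt_pi (.lower (i + 1))
      rw [xa]
      unfold cyclicPos
      rw [if_pos h1]
      split_ifs with h
      · have : 0 ≤ angle y - angle (.lower (i + 1)) := by
          by_contra hc
          exact absurd hn (not_le.2 (mul_neg_of_pos_of_neg (by linarith) (not_le.1 hc)))
        linarith
      · linarith
    exact hcon a le_rfl (cyclicPos_injective _ (le_antisymm (hle a le_rfl) hge))
  have hfin : {e ∈ T | Pt.lower i ∈ e}.Finite := by
    refine ((Finset.range (a + 1)).image fun k => s(Pt.lower i, x k)).finite_toSet.subset ?_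
    rintro e ⟨heT, hie⟩
    obtain ⟨y, rfl⟩ := hie
    have hy : y ≠ .lower i := fun h => (hT.prop.1 _ heT).1 (by simp [h])
    obtain ⟨k, hk, rfl⟩ := nbr y hy (Or.inl heT)
    simp only [Finset.coe_image, mem_image, Finset.mem_coe, Finset.mem_range]
    exact ⟨k, by omega, rfl⟩
  have htri : trianglesAt A T i =
      ((Finset.range a).image fun k => ({Pt.lower i, x k, x (k + 1)} : Finset Pt) :
        Finset (Finset Pt)) := by
    ext t
    simp only [Finset.coe_image, mem_image, Finset.mem_coe, Finset.mem_range]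
    constructor
    · rintro ⟨⟨hc, hs⟩, hi⟩
      have hc2 : (t.erase (Pt.lower i)).card = 2 := by rw [Finset.card_erase_of_mem hi, hc]
      obtain ⟨y, z, hyz, e⟩ := Finset.card_eq_two.1 hc2
      have hy : y ∈ t.erase (Pt.lower i) := by rw [e]; simp
      have hz : z ∈ t.erase (Pt.lower i) := by rw [e]; simp
      have ht : t = {Pt.lower i, y, z} := by rw [← e, Finset.insert_erase hi]
      rw [Finset.mem_erase] at hy hz
      obtain ⟨k, hk, rfl⟩ := nbr y hy.1 (hs _ hi _ hy.2 hy.1.symm)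
      obtain ⟨l, hl, rfl⟩ := nbr z hz.1 (hs _ hi _ hz.2 hz.1.symm)
      have hkl := hs _ hy.2 _ hz.2 hyz
      -- A side that skips `x (k + 1)` would cross the spoke leading to it.
      have consec : ∀ k l, k < l → l ≤ a → IsSide A T s(x k, x l) → l = k + 1 := by
        intro k l h hl hkl
        by_contra hne'
        refine (hspoke (k + 1) (by omega)).not_linked hT hkl (Linked.swap_right ?_)
        exact linked_of_cyclicPos_lt (hne _ (by omega)) (hne _ hl) (hne _ (by omega))
          (hanti _ _ (by omega) hl) (hanti _ _ (by omega) (by omega))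
      rcases lt_trichotomy k l with h | h | h
      · obtain rfl := consec k l h hl hkl
        exact ⟨k, hl, ht.symm⟩
      · exact absurd (congrArg x h) hyz
      · rw [Sym2.eq_swap] at hkl
        obtain rfl := consec l k h hk hkl
        refine ⟨l, hk, ?_⟩
        rw [ht, Finset.pair_comm]
    · rintro ⟨k, hk, rfl⟩
      have n1 := hne k (by omega)
      have n2 := hne (k + 1) (by omega)
      have n3 : x k ≠ x (k + 1) := fun h => by
        have := xinj k (by omega) (k + 1) (by omega) h
        omega
      have s1 := hspoke k (by omega)
      have s2 := hspoke (k + 1) (by omega)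
      have s3 := hrim k hk
      refine ⟨⟨Finset.card_eq_three.2 ⟨_, _, _, n1.symm, n2.symm, n3, rfl⟩, ?_⟩, by simp⟩
      intro u hu v hv huv
      change IsSide A T s(u, v)
      simp only [Finset.mem_insert, Finset.mem_singleton] at hu hv
      rcases hu with rfl | rfl | rfl <;> rcases hv with rfl | rfl | rfl <;>
        first
        | exact absurd rfl huv
        | assumption
        | (rw [Sym2.eq_swap]; assumption)
  refine ⟨hfin, ?_, ?_⟩
  · rw [htri]; exact Finset.finite_toSet _
  · rw [htri, Set.ncard_coe_finset, Finset.card_image_of_injOn, Finset.card_range]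
    intro k hk l hl e
    simp only [Finset.coe_range, mem_Iio] at hk hl
    have m1 : x k ∈ ({Pt.lower i, x l, x (l + 1)} : Finset Pt) := by
      rw [← show _ = ({Pt.lower i, x l, x (l + 1)} : Finset Pt) from e]; simp
    have m2 : x l ∈ ({Pt.lower i, x k, x (k + 1)} : Finset Pt) := by
      rw [show ({Pt.lower i, x k, x (k + 1)} : Finset Pt) = _ from e]; simp
    simp only [Finset.mem_insert, Finset.mem_singleton] at m1 m2
    have c1 : k = l ∨ k = l + 1 := by
      rcases m1 with h | h | h
      · exact absurd h (hne k (by omega))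
      · exact Or.inl (xinj _ (by omega) _ (by omega) h)
      · exact Or.inr (xinj _ (by omega) _ (by omega) h)
    have c2 : l = k ∨ l = k + 1 := by
      rcases m2 with h | h | h
      · exact absurd h (hne l (by omega))
      · exact Or.inl (xinj _ (by omega) _ (by omega) h)
      · exact Or.inr (xinj _ (by omega) _ (by omega) h)
    omega

end Strip

/-! ### The Farey graph on the marked points -/

namespace Strip

variable {m : ℤ → ℤ → ℤ}

/-- The rational directions that come after all vectors of the frieze. -/
def upperPoints (m : ℤ → ℤ → ℤ) : Set ℚ :=
  {q | ∀ j, 0 < det (friezeVec m j) (q.num, (q.den : ℤ))}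

/-- The marked points of the strip, without the limit points. -/
def IsVertex (m : ℤ → ℤ → ℤ) : Pt → Prop
  | .lower _ => True
  | .upper q => q ∈ upperPoints m
  | .negInf => False
  | .posInf => False

/-- The primitive vector of a marked point. -/
def vertexVec (m : ℤ → ℤ → ℤ) : Pt → ℤ × ℤ
  | .lower j => friezeVec m j
  | .upper q => (q.num, (q.den : ℤ))
  | .negInf => 0
  | .posInf => 0

theorem IsVertex.available {x : Pt} (h : IsVertex m x) : x.Available (upperPoints m) := by
  rcases x with i | q | _ | _
  · trivial
  · exact h
  · trivial
  · trivial

/-- Lower points run counterclockwise from left to right, and upper points follow from right to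
left, that is, by decreasing rational. The mixed case is the defining condition of `upperPoints`. -/
theorem det_pos_of_angle_lt (hm : IsInfiniteFrieze m) {x y : Pt} (hx : IsVertex m x)
    (hy : IsVertex m y) (h : angle x < angle y) : 0 < det (vertexVec m x) (vertexVec m y) := by
  rcases x with i | p | _ | _ <;> rcases y with j | q | _ | _
  case lower.lower =>
    simp only [vertexVec, det_friezeVec hm]
    exact entry_pos hm (angle_lower_lt.1 h)
  case lower.upper => exact hy i
  case upper.lower => linarith [angle_upper_pos p, angle_lower_neg j]
  case upper.upper =>
    have := (Rat.lt_iff _ _).1 (angle_upper_lt.1 h)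
    simp only [vertexVec, det]
    linarith
  all_goals first | exact hx.elim | exact hy.elim

theorem angle_lt_of_det_pos (hm : IsInfiniteFrieze m) {x y : Pt} (hx : IsVertex m x)
    (hy : IsVertex m y) (h : 0 < det (vertexVec m x) (vertexVec m y)) : angle x < angle y := by
  rcases lt_trichotomy (angle x) (angle y) with h' | h' | h'
  · exact h'
  · rw [angle_injective h'] at h
    unfold det at h; linarith
  · have := det_pos_of_angle_lt hm hy hx h'
    rw [det_swap] at this; linarith

/-- Recognizes a marked point whose vector is known only up to sign, as happens at the two ends of
the fan. -/
theorem eq_of_det_eq_zero (hm : IsInfiniteFrieze m) {x y : Pt} (hx : IsVertex m x)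
    (hy : IsVertex m y) (h : det (vertexVec m x) (vertexVec m y) = 0) : x = y := by
  apply angle_injective
  rcases lt_trichotomy (angle x) (angle y) with h' | h' | h'
  · linarith [det_pos_of_angle_lt hm hx hy h']
  · exact h'
  · have := det_pos_of_angle_lt hm hy hx h'
    rw [det_swap] at this; linarith

/-- The edges between marked points whose vectors form a basis of the lattice. -/
def IsFareyEdge (m : ℤ → ℤ → ℤ) (e : Sym2 Pt) : Prop :=
  ∃ x y, e = s(x, y) ∧ IsVertex m x ∧ IsVertex m y ∧ det (vertexVec m x) (vertexVec m y) = 1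

theorem det_mul_det (a b c d : ℤ × ℤ) : det a b * det c d = det a c * det b d + det a d * det c b := by
  unfold det; ring

/-- By Ptolemy's relation, edges of the Farey graph do not cross. -/
theorem not_linked_of_det_eq_one (hm : IsInfiniteFrieze m) {x y u v : Pt} (hx : IsVertex m x)
    (hy : IsVertex m y) (hu : IsVertex m u) (hv : IsVertex m v)
    (h : det (vertexVec m x) (vertexVec m y) = 1) (h' : det (vertexVec m u) (vertexVec m v) = 1) :
    ¬ Linked (angle x) (angle y) (angle u) (angle v) := by
  have cross : ∀ {x y u v : Pt}, IsVertex m x → IsVertex m y → IsVertex m u → IsVertex m v →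
      det (vertexVec m x) (vertexVec m y) = 1 → det (vertexVec m u) (vertexVec m v) = 1 →
      angle x < angle u → angle u < angle y → angle y < angle v → False := by
    intro x y u v hx hy hu hv h h' h1 h2 h3
    -- The left side of the Plücker relation is 1, while the right side is a sum of two positive
    -- integers.
    have e := det_mul_det (vertexVec m x) (vertexVec m y) (vertexVec m u) (vertexVec m v)
    have p1 := mul_pos (det_pos_of_angle_lt hm hx hu h1) (det_pos_of_angle_lt hm hy hv h3)
    have p2 := mul_pos (det_pos_of_angle_lt hm hx hv (by linarith))
      (det_pos_of_angle_lt hm hu hy h2)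
    rw [h, h'] at e
    linarith
  have lxy := angle_lt_of_det_pos hm hx hy (by rw [h]; exact one_pos)
  have luv := angle_lt_of_det_pos hm hu hv (by rw [h']; exact one_pos)
  intro hl
  rcases mul_neg_iff.1 hl with ⟨h1, h2⟩ | ⟨h1, h2⟩
  · rcases mul_neg_iff.1 h2 with h2 | h2
    · refine cross hu hv hx hy h' h ?_ (by linarith) (by linarith)
      rcases mul_pos_iff.1 h1 with h1 | h1 <;> linarith
    · linarith
  · rcases mul_neg_iff.1 h1 with h1 | h1
    · refine cross hx hy hu hv h h' (by linarith) (by linarith) ?_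
      rcases mul_pos_iff.1 h2 with h2 | h2 <;> linarith
    · linarith

theorem exists_triangulation_of_frieze (hm : IsInfiniteFrieze m) :
    ∃ T, IsTriangulation (upperPoints m) T ∧
      ∀ e, IsFareyEdge m e → IsSide (upperPoints m) T e := by
  have hne : ∀ x y : Pt, det (vertexVec m x) (vertexVec m y) = 1 → x ≠ y := by
    rintro x y h rfl
    unfold det at h; linarith
  -- Boundary segments are not arcs, so they are left out of the extension and return through
  -- `IsSide`.
  set S : Set (Sym2 Pt) := {e | IsFareyEdge m e ∧ ¬ IsBoundarySegment (upperPoints m) e}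
  have harc : ∀ e ∈ S, IsArc (upperPoints m) e := by
    rintro _ ⟨⟨x, y, rfl, hx, hy, h⟩, hb⟩
    refine ⟨by simpa using hne x y h, fun z hz => ?_, hb⟩
    rcases Sym2.mem_iff.1 hz with rfl | rfl
    · exact hx.available
    · exact hy.available
  have hcomp : S.Pairwise Compatible := by
    rintro _ ⟨⟨x, y, rfl, hx, hy, h⟩, -⟩ _ ⟨⟨u, v, rfl, hu, hv, h'⟩, -⟩ hxyuv
    exact compatible_of_not_linked (hne x y h) (hne u v h') hxyuv
      (not_linked_of_det_eq_one hm hx hy hu hv h h')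
  obtain ⟨T, hS, hT⟩ := exists_triangulation_superset harc hcomp
  refine ⟨T, hT, fun e he => ?_⟩
  by_cases hb : IsBoundarySegment (upperPoints m) e
  · exact Or.inr hb
  · exact Or.inl (hS ⟨he, hb⟩)

/-! ### The fan of Farey neighbours of a lower marked point -/

/-- The vectors of the neighbours of `(i, 0)`, up to sign. -/
def spokeVec (m : ℤ → ℤ → ℤ) (i k : ℤ) : ℤ × ℤ := k • friezeVec m i - friezeVec m (i - 1)

theorem det_friezeVec_pred (hm : IsInfiniteFrieze m) (i : ℤ) :
    det (friezeVec m (i - 1)) (friezeVec m i) = 1 := by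
  have := entry_succ hm (i - 1)
  rw [sub_add_cancel] at this
  rw [det_friezeVec hm, this]

theorem det_friezeVec_spokeVec (hm : IsInfiniteFrieze m) (i k : ℤ) :
    det (friezeVec m i) (spokeVec m i k) = 1 := by
  rw [← det_friezeVec_pred hm i]
  simp only [det, spokeVec, Prod.fst_sub, Prod.snd_sub, Prod.smul_fst, Prod.smul_snd, smul_eq_mul]
  ring

theorem det_spokeVec (hm : IsInfiniteFrieze m) (i k l : ℤ) :
    det (spokeVec m i k) (spokeVec m i l) = k - l := by
  have h := det_friezeVec_pred hm i
  simp only [det, spokeVec, Prod.fst_sub, Prod.snd_sub, Prod.smul_fst, Prod.smul_snd,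
    smul_eq_mul] at *
  linear_combination (k - l) * h

theorem spokeVec_quiddity (hm : IsInfiniteFrieze m) (i : ℤ) :
    spokeVec m i (m i i) = friezeVec m (i + 1) := (friezeVec_add hm i).symm

theorem spokeVec_zero (i : ℤ) : spokeVec m i 0 = -friezeVec m (i - 1) := by
  simp [spokeVec]

theorem eq_combination_of_det_eq_one {u v : ℤ × ℤ} (h : det u v = 1) (w : ℤ × ℤ) :
    w = det u w • v - det v w • u := by
  unfold det at *
  ext
  · simp only [Prod.fst_sub, Prod.smul_fst, smul_eq_mul]; linear_combination (-w.1) * h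
  · simp only [Prod.snd_sub, Prod.smul_snd, smul_eq_mul]; linear_combination (-w.2) * h

theorem det_combination (v a b : ℤ × ℤ) (p q : ℤ) :
    det v (p • a - q • b) = p * det v a - q * det v b := by
  simp only [det, Prod.fst_sub, Prod.snd_sub, Prod.smul_fst, Prod.smul_snd, smul_eq_mul]
  ring

/-- A lattice vector `w` that forms a basis with `friezeVec m i` and changes sides with respect to
the frieze vectors at `j + 1`, to the right of `i`, is a frieze vector. -/
theorem eq_friezeVec_of_right (hm : IsInfiniteFrieze m) {i j : ℤ} (hij : i < j) {w : ℤ × ℤ}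
    (hw : det (friezeVec m i) w = 1) (h1 : 0 < det (friezeVec m j) w)
    (h2 : det (friezeVec m (j + 1)) w ≤ 0) : w = friezeVec m (j + 1) := by
  have hd : det (friezeVec m j) (friezeVec m (j + 1)) = 1 := by
    rw [det_friezeVec hm, entry_succ hm]
  have e := eq_combination_of_det_eq_one hd w
  have e' := hw
  rw [e, det_combination, det_friezeVec hm, det_friezeVec hm] at e'
  have p1 := entry_pos hm hij
  have p2 := entry_pos hm (show i < j + 1 by omega)
  -- In `e'` the number 1 is a positive integer plus a nonnegative multiple of a positive integer,
  -- so the second term vanishes and the coefficient in the first is 1.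
  have hz : det (friezeVec m (j + 1)) w = 0 := by nlinarith
  rw [hz, zero_mul, sub_zero] at e'
  have ho : det (friezeVec m j) w = 1 := by
    have := Int.eq_one_or_neg_one_of_mul_eq_one e'
    omega
  rw [ho, hz] at e
  simpa using e

/-- The mirror image of `eq_friezeVec_of_right`. -/
theorem eq_neg_friezeVec_of_left (hm : IsInfiniteFrieze m) {i j : ℤ} (hij : j < i) {w : ℤ × ℤ}
    (hw : det (friezeVec m i) w = 1) (h1 : 0 < det (friezeVec m j) w)
    (h2 : det (friezeVec m (j - 1)) w ≤ 0) : w = -friezeVec m (j - 1) := by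
  have e := eq_combination_of_det_eq_one (det_friezeVec_pred hm j) w
  have e' := hw
  rw [e, det_combination, det_friezeVec hm, det_friezeVec hm, entry_swap hm j i,
    entry_swap hm (j - 1) i] at e'
  have p1 := entry_pos hm hij
  have p2 := entry_pos hm (show j - 1 < i by omega)
  have hz : det (friezeVec m (j - 1)) w = 0 := by nlinarith
  rw [hz, zero_mul, zero_sub, mul_neg, neg_neg] at e'
  have ho : det (friezeVec m j) w = 1 := by
    have := Int.eq_one_or_neg_one_of_mul_eq_one e'
    omega
  rw [ho, hz] at e
  simpa using e

/-- Positivity against v_0 = (1, 0) makes the second coordinate positive, and determinant 1 with a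
lattice vector makes the coordinates coprime: a fraction in lowest terms. -/
theorem exists_upper_of_det_pos (hm : IsInfiniteFrieze m) {i : ℤ} {w : ℤ × ℤ}
    (hw : det (friezeVec m i) w = 1) (h : ∀ j, 0 < det (friezeVec m j) w) :
    ∃ q ∈ upperPoints m, vertexVec m (.upper q) = w := by
  have hpos : 0 < w.2 := by
    have := h 0
    rw [friezeVec_zero hm] at this
    simpa [det] using this
  have hcop : IsCoprime w.1 w.2 := ⟨-(friezeVec m i).2, (friezeVec m i).1, by
    rw [← hw]; unfold det; ring⟩
  let q : ℚ := ⟨w.1, w.2.toNat, by omega, by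
    have := Int.isCoprime_iff_gcd_eq_one.1 hcop
    rw [Nat.Coprime, ← this, Int.gcd]
    congr 1
    omega⟩
  have e : ((q.num, (q.den : ℤ)) : ℤ × ℤ) = w :=
    Prod.ext rfl (Int.toNat_of_nonneg hpos.le)
  exact ⟨q, fun j => by rw [e]; exact h j, e⟩

theorem exists_vertex_of_spokeVec (hm : IsInfiniteFrieze m) (i : ℤ) {k : ℤ} (hk : 0 ≤ k)
    (hk' : k ≤ m i i) : ∃ x, IsVertex m x ∧
      (angle (.lower i) < angle x ∧ vertexVec m x = spokeVec m i k ∨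
        angle x < angle (.lower i) ∧ vertexVec m x = -spokeVec m i k) := by
  set w := spokeVec m i k with hw
  have h1 : det (friezeVec m i) w = 1 := det_friezeVec_spokeVec hm i k
  by_cases hall : ∀ j, 0 < det (friezeVec m j) w
  · obtain ⟨q, hq, e⟩ := exists_upper_of_det_pos hm h1 hall
    exact ⟨.upper q, hq, Or.inl ⟨(angle_lower_neg i).trans (angle_upper_pos q), e⟩⟩
  have right : ∀ j, i < j → w = friezeVec m j → ∃ x, IsVertex m x ∧
      (angle (.lower i) < angle x ∧ vertexVec m x = w ∨
        angle x < angle (.lower i) ∧ vertexVec m x = -w) := fun j hj e =>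
    ⟨.lower j, trivial, Or.inl ⟨angle_lower_lt.2 hj, e.symm⟩⟩
  have left : ∀ j, j < i → w = -friezeVec m j → ∃ x, IsVertex m x ∧
      (angle (.lower i) < angle x ∧ vertexVec m x = w ∨
        angle x < angle (.lower i) ∧ vertexVec m x = -w) := fun j hj e =>
    ⟨.lower j, trivial, Or.inr ⟨angle_lower_lt.2 hj, by rw [e, neg_neg]; rfl⟩⟩
  rcases eq_or_lt_of_le hk with rfl | hk
  · exact left (i - 1) (by omega) (spokeVec_zero i)
  rcases eq_or_lt_of_le hk' with rfl | hk'
  · exact right (i + 1) (by omega) (spokeVec_quiddity hm i)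
  have hr : 0 < det (friezeVec m (i + 1)) w := by
    rw [← spokeVec_quiddity hm, hw, det_spokeVec hm]; omega
  have hl : 0 < det (friezeVec m (i - 1)) w := by
    have : friezeVec m (i - 1) = -spokeVec m i 0 := by rw [spokeVec_zero, neg_neg]
    have h2 : det (friezeVec m (i - 1)) w = -det (spokeVec m i 0) w := by
      rw [this]; simp only [det, Prod.fst_neg, Prod.snd_neg]; ring
    rw [h2, hw, det_spokeVec hm]; omega
  -- For 0 < k < a_i, `w` is positive against v_{i-1}, v_i and v_{i+1}. Not being positive against
  -- all frieze vectors, it has a first sign change on one side, and there it is ± a frieze vector.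
  by_cases hR : ∀ n : ℕ, 0 < det (friezeVec m (i + 1 + n)) w
  · by_cases hL : ∀ n : ℕ, 0 < det (friezeVec m (i - 1 - n)) w
    · refine absurd (fun j => ?_) hall
      rcases lt_trichotomy j i with h | h | h
      · have := hL (i - 1 - j).toNat
        rwa [Int.toNat_of_nonneg (by omega), show i - 1 - (i - 1 - j) = j by ring] at this
      · rw [h, h1]; exact one_pos
      · have := hR (j - (i + 1)).toNat
        rwa [Int.toNat_of_nonneg (by omega), show i + 1 + (j - (i + 1)) = j by ring] at this
    · obtain ⟨n, h2, h3⟩ : ∃ n : ℕ, 0 < det (friezeVec m (i - 1 - n)) w ∧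
          det (friezeVec m (i - 1 - n - 1)) w ≤ 0 := by
        by_contra! hcon
        refine hL fun n => ?_
        induction n with
        | zero => simpa using hl
        | succ n ih =>
          rw [show i - 1 - ((n + 1 : ℕ) : ℤ) = i - 1 - n - 1 by push_cast; ring]
          exact hcon n ih
      exact left _ (by omega) (eq_neg_friezeVec_of_left hm (by omega) h1 h2 h3)
  · obtain ⟨n, h2, h3⟩ : ∃ n : ℕ, 0 < det (friezeVec m (i + 1 + n)) w ∧
        det (friezeVec m (i + 1 + n + 1)) w ≤ 0 := by
      by_contra! hcon
      refine hR fun n => ?_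
      induction n with
      | zero => simpa using hr
      | succ n ih =>
        rw [show i + 1 + ((n + 1 : ℕ) : ℤ) = i + 1 + n + 1 by push_cast; ring]
        exact hcon n ih
    exact right _ (by omega) (eq_friezeVec_of_right hm (by omega) h1 h2 h3)

theorem det_neg_left (v w : ℤ × ℤ) : det (-v) w = -det v w := by
  simp only [det, Prod.fst_neg, Prod.snd_neg]; ring

theorem det_neg_right (v w : ℤ × ℤ) : det v (-w) = -det v w := by
  simp only [det, Prod.fst_neg, Prod.snd_neg]; ring

theorem isFareyEdge_of_det {x y : Pt} (hx : IsVertex m x) (hy : IsVertex m y)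
    (h : det (vertexVec m x) (vertexVec m y) = 1 ∨ det (vertexVec m x) (vertexVec m y) = -1) :
    IsFareyEdge m s(x, y) := by
  rcases h with h | h
  · exact ⟨x, y, rfl, hx, hy, h⟩
  · exact ⟨y, x, Sym2.eq_swap, hy, hx, by rw [det_swap, h, neg_neg]⟩

/-- The Farey neighbours of `(i, 0)` form a fan of `m i i` triangles. -/
theorem exists_fan (hm : IsInfiniteFrieze m) (i : ℤ) : ∃ x : ℕ → Pt,
    x 0 = .lower (i - 1) ∧ x (m i i).toNat = .lower (i + 1) ∧
    (∀ k ≤ (m i i).toNat, x k ≠ .lower i) ∧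
    (∀ k l, k < l → l ≤ (m i i).toNat →
      cyclicPos (.lower i) (x l) < cyclicPos (.lower i) (x k)) ∧
    (∀ k ≤ (m i i).toNat, IsFareyEdge m s(.lower i, x k)) ∧
    ∀ k < (m i i).toNat, IsFareyEdge m s(x k, x (k + 1)) := by
  have ha : 0 < m i i := hm.pos i i le_rfl
  have hex : ∀ k : ℕ, ∃ x, k ≤ (m i i).toNat → IsVertex m x ∧
      (angle (.lower i) < angle x ∧ vertexVec m x = spokeVec m i k ∨
        angle x < angle (.lower i) ∧ vertexVec m x = -spokeVec m i k) := fun k => by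
    by_cases hk : k ≤ (m i i).toNat
    · obtain ⟨x, hx⟩ := exists_vertex_of_spokeVec hm i (k := k) (by omega) (by omega)
      exact ⟨x, fun _ => hx⟩
    · exact ⟨.negInf, fun h => absurd h hk⟩
  choose x hx using hex
  have hdet : ∀ k l, k ≤ (m i i).toNat → l ≤ (m i i).toNat →
      det (vertexVec m (x k)) (vertexVec m (x l)) = (k - l : ℤ) ∨
      det (vertexVec m (x k)) (vertexVec m (x l)) = -(k - l : ℤ) := by
    intro k l hk hl
    have h := det_spokeVec hm i k l
    rcases (hx k hk).2 with ⟨-, e⟩ | ⟨-, e⟩ <;> rcases (hx l hl).2 with ⟨-, e'⟩ | ⟨-, e'⟩ <;>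
      rw [e, e'] <;> simp [det_neg_left, det_neg_right, h]
  refine ⟨x, ?_, ?_, ?_, ?_, ?_, ?_⟩
  · have hv := hx 0 (Nat.zero_le _)
    refine eq_of_det_eq_zero hm hv.1 trivial ?_
    have e : spokeVec m i (0 : ℕ) = -friezeVec m (i - 1) := spokeVec_zero i
    rcases hv.2 with ⟨-, h⟩ | ⟨-, h⟩ <;> rw [h, e] <;> simp only [vertexVec, det, Prod.fst_neg,
      Prod.snd_neg] <;> ring
  · have hv := hx _ le_rfl
    refine eq_of_det_eq_zero hm hv.1 trivial ?_
    have e : spokeVec m i ((m i i).toNat : ℕ) = friezeVec m (i + 1) := by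
      rw [Int.toNat_of_nonneg ha.le, spokeVec_quiddity hm]
    rcases hv.2 with ⟨-, h⟩ | ⟨-, h⟩ <;> rw [h, e] <;> simp only [vertexVec, det, Prod.fst_neg,
      Prod.snd_neg] <;> ring
  · intro k hk h
    rcases (hx k hk).2 with ⟨h', -⟩ | ⟨h', -⟩ <;> rw [h] at h' <;> exact lt_irrefl _ h'
  · intro k l hkl hl
    have hk : k ≤ (m i i).toNat := by omega
    have hlk : (k : ℤ) < l := by exact_mod_cast hkl
    have hd := det_spokeVec hm i l k
    obtain ⟨vk, hk'⟩ := hx k hk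
    obtain ⟨vl, hl'⟩ := hx l hl
    have := neg_pi_le_angle (x k)
    have := angle_lt_pi (x l)
    unfold cyclicPos
    rcases hk' with ⟨ck, ek⟩ | ⟨ck, ek⟩ <;> rcases hl' with ⟨cl, el⟩ | ⟨cl, el⟩
    · rw [if_pos ck, if_pos cl]
      exact angle_lt_of_det_pos hm vl vk (by rw [ek, el, hd]; omega)
    · have := det_pos_of_angle_lt hm vl vk (cl.trans ck)
      rw [ek, el, det_neg_left, hd] at this
      omega
    · rw [if_neg ck.not_gt, if_pos cl]
      linarith
    · rw [if_neg ck.not_gt, if_neg cl.not_gt]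
      have := angle_lt_of_det_pos hm vl vk
        (by rw [ek, el, det_neg_left, det_neg_right, neg_neg, hd]; omega)
      linarith
  · intro k hk
    refine isFareyEdge_of_det trivial (hx k hk).1 ?_
    have h : det (vertexVec m (.lower i)) (spokeVec m i k) = 1 := det_friezeVec_spokeVec hm i k
    rcases (hx k hk).2 with ⟨-, e⟩ | ⟨-, e⟩ <;> rw [e] <;> simp [det_neg_right, h]
  · intro k hk
    refine isFareyEdge_of_det (hx k hk.le).1 (hx (k + 1) hk).1 ?_
    have := hdet k (k + 1) hk.le hk
    push_cast at this
    omega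

end Strip

theorem theorem5p2 (m : ℤ → ℤ → ℤ) (hm : IsInfiniteFrieze m) :
    Strip.Realizable (quiddityRow m) := by
  obtain ⟨T, hT, hside⟩ := Strip.exists_triangulation_of_frieze hm
  have key : ∀ i : ℤ, {e ∈ T | Strip.Pt.lower i ∈ e}.Finite ∧
      (Strip.trianglesAt (Strip.upperPoints m) T i).Finite ∧
      (Strip.trianglesAt (Strip.upperPoints m) T i).ncard = (m i i).toNat := by
    intro i
    obtain ⟨x, h1, h2, h3, h4, h5, h6⟩ := Strip.exists_fan hm i
    exact Strip.triangles_of_fan hT i _ x h1 h2 h3 h4 (fun k hk => hside _ (h5 k hk))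
      fun k hk => hside _ (h6 k hk)
  refine ⟨Strip.upperPoints m, T, ⟨hT, fun i => (key i).1⟩, fun i => ⟨(key i).2.1, ?_⟩⟩
  rw [(key i).2.2, Int.toNat_of_nonneg (hm.pos i i le_rfl).le]
  rfl
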